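/- Let $G$ be a finite, simple, connected, undirected graph with vertex set $V$, $n=|V|$. A \emph{bond} of $G$ is an inclusion-wise minimal set $F\subseteq E(G)$ such that $G-F$ is disconnected. A \emph{nice tree decomposition} of $G$ is a rooted tree with a bag $X_\ell\subseteq V$ at every node $\ell$ which is a tree decomposition of $G$ (every vertex is in a bag, both ends of every edge are in a common bag, and for every vertex the nodes whose bags contain it induce a connected subtree), whose root bag is empty, and each of whose nodes is of one of five types: \emph{leaf} (no child, empty bag); \emph{introduce vertex} $v$ (one child $\ell'$, $v\notin X_{\ell'}$, $X_\ell=X_{\ell'}\cup\{v\}$); \emph{introduce edge} $uv$ (one child $\ell'$, $u,v\in X_\ell=X_{\ell'}$); \emph{forget vertex} $v$ (one child $\ell'$, $v\in X_{\ell'}$, $X_\ell=X_{\ell'}\setminus\{v\}$); \emph{join} (two children $\ell',\ell''$, $X_\ell=X_{\ell'}=X_{\ell''}$). Moreover, only edges of $G$ are introduced, each of them exactly once. Its width $tw$ is the size of a largest bag minus one. As usual, the number of nodes is assumed to be $O((tw+1)\,n)$. \textbf{Theorem.} Given a nice tree decomposition of $G$ of width $tw$ with $O((tw+1)\,n)$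 nodes, a bond of $G$ of maximum size can be found in time $2^{O(tw\log tw)}\cdot n$. Precisely: there is one program $P$ such that for every $C\in\mathbb N$ there is $K\in\mathbb N$ with the following property. For every $n$, every connected graph $G$ on $\{0,\dots,n-1\}$ and every nice tree decomposition of $G$ of width $tw$ with at most $C(tw+1)n$ nodes, $P$, given the decomposition (the tree with the node types and the introduced or forgotten vertices and edges), halts after at most $K\cdot 2^{K\,tw\log_2 tw}\cdot n$ steps (with $tw\log_2 tw=0$ for $tw\le 1$) and outputs a list that contains each edge of a maximum-size bond of $G$ exactly once, or the empty list if $G$ has no bond (which happens only for $n=1$). Programs are finite systems of recursive first-order functions over data built from natural numbers and ordered pairs. The unit-cost steps are: reading a variable or a constant, addition, truncated subtraction and comparison of numbers, forming a pair, testing for a pair and accessing its components, binding a variable, and calling a function; each takes $O(1)$ steps of a random access machine. All sums formed are at most $(n+1)^K$, so that numbers have $O(\log(n+1))$ bits. -/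

import Mathlib

namespace LargestBond

/-! ### Bonds -/

section Bonds

variable {V : Type*}

/-- A disconnecting set of `G`: a set of edges of `G` whose removal disconnects `G`. -/
def IsDisconnectingSet (G : SimpleGraph V) (F : Set (Sym2 V)) : Prop :=
  F ⊆ G.edgeSet ∧ ¬ (G.deleteEdges F).Connected

/-- A bond of a (connected) graph: an inclusion-wise minimal disconnecting set. -/
def IsBond (G : SimpleGraph V) (F : Set (Sym2 V)) : Prop :=
  Minimal (IsDisconnectingSet G) F

/-- A bond with the largest possible number of edges. -/
def IsMaximumBond (G : SimpleGraph V) (F : Set (Sym2 V)) : Prop :=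
  IsBond G F ∧ ∀ F' : Set (Sym2 V), IsBond G F' → F'.encard ≤ F.encard

end Bonds

/-! ### Nice tree decompositions -/

/-- Rooted trees with the five node types of a nice tree decomposition with introduce-edge nodes.
Each constructor is the root of the tree, its tree arguments are the children of the root. -/
inductive NTree (V : Type*) where
  | leaf : NTree V
  | introVertex (v : V) (t : NTree V) : NTree V
  | introEdge (u v : V) (t : NTree V) : NTree V
  | forget (v : V) (t : NTree V) : NTree V
  | join (s t : NTree V) : NTree V

namespace NTree

variable {V : Type*}

/-- The bag of the root. -/
def bag [DecidableEq V] : NTree V → Finset V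
  | leaf => ∅
  | introVertex v t => insert v t.bag
  | introEdge _ _ t => t.bag
  | forget v t => t.bag.erase v
  | join s _ => s.bag

/-- The local conditions on the nodes: an introduced vertex is not in the bag of the child, the ends
of an introduced edge are in the bag, a forgotten vertex is in the bag of the child, and the two
children of a join node have the same bag. (Leaf bags are empty by the definition of `bag`.) -/
def WellFormed [DecidableEq V] : NTree V → Prop
  | leaf => True
  | introVertex v t => v ∉ t.bag ∧ t.WellFormed
  | introEdge u v t => u ∈ t.bag ∧ v ∈ t.bag ∧ t.WellFormed
  | forget v t => v ∈ t.bag ∧ t.WellFormed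
  | join s t => s.bag = t.bag ∧ s.WellFormed ∧ t.WellFormed

/-- The list of the edges introduced at the introduce-edge nodes of the tree. -/
def edges : NTree V → List (Sym2 V)
  | leaf => []
  | introVertex _ t => t.edges
  | introEdge u v t => s(u, v) :: t.edges
  | forget _ t => t.edges
  | join s t => s.edges ++ t.edges

/-- The number of nodes. -/
def numNodes : NTree V → ℕ
  | leaf => 1
  | introVertex _ t => t.numNodes + 1
  | introEdge _ _ t => t.numNodes + 1
  | forget _ t => t.numNodes + 1
  | join s t => s.numNodes + t.numNodes + 1

/-- The size of a largest bag. -/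
def maxBagCard [DecidableEq V] : NTree V → ℕ
  | leaf => 0
  | introVertex v t => max (introVertex v t).bag.card t.maxBagCard
  | introEdge u v t => max (introEdge u v t).bag.card t.maxBagCard
  | forget v t => max (forget v t).bag.card t.maxBagCard
  | join s t => max (join s t).bag.card (max s.maxBagCard t.maxBagCard)

/-- The width: the size of a largest bag minus one. -/
def width [DecidableEq V] (t : NTree V) : ℕ := t.maxBagCard - 1

/-- The subtree at a child of the root; an only child is the child number `false`. -/
def child : NTree V → Bool → Option (NTree V)
  | introVertex _ t, false => some t
  | introEdge _ _ t, false => some t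
  | forget _ t, false => some t
  | join s _, false => some s
  | join _ t, true => some t
  | _, _ => none

/-- The subtree whose root is reached from the root by following an address downwards. -/
def subtreeAt : NTree V → List Bool → Option (NTree V)
  | t, [] => some t
  | t, b :: p => (t.child b).bind fun s => s.subtreeAt p

/-- The nodes of a tree, given by their addresses. -/
abbrev Node (t : NTree V) : Type := {p : List Bool // (t.subtreeAt p).isSome}

/-- The bag of a node. -/
def nodeBag [DecidableEq V] (t : NTree V) (p : t.Node) : Finset V :=
  ((t.subtreeAt p.1).get p.2).bag

/-- The underlying undirected tree: every node is joined to its children. -/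
def nodeGraph (t : NTree V) : SimpleGraph t.Node :=
  SimpleGraph.fromRel fun p q => ∃ b : Bool, q.1 = p.1 ++ [b]

end NTree

/-- `t` is a nice tree decomposition of `G`: a tree decomposition (the first three fields) with empty
root bag, whose nodes are of the five types, and in which every edge of `G` is introduced exactly
once. -/
structure IsNiceTreeDecomposition {V : Type*} [DecidableEq V] (G : SimpleGraph V) (t : NTree V) :
    Prop where
  vertex_mem : ∀ v : V, ∃ p : t.Node, v ∈ t.nodeBag p
  edge_mem : ∀ u v : V, G.Adj u v → ∃ p : t.Node, u ∈ t.nodeBag p ∧ v ∈ t.nodeBag p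
  connected : ∀ v : V, (t.nodeGraph.induce {p : t.Node | v ∈ t.nodeBag p}).Preconnected
  root_bag : t.bag = ∅
  wellFormed : t.WellFormed
  edges_nodup : t.edges.Nodup
  mem_edges : ∀ e : Sym2 V, e ∈ t.edges ↔ e ∈ G.edgeSet

/-! ### The model of computation

A machine whose memory consists of words (natural numbers) and of pairs (two-field records, created
dynamically and accessed through pointers). Programs are finite systems of first-order functions
that may call each other recursively. Every elementary operation takes one step, and each of them
takes a constant number of steps of a random access machine that stores every pair in two
consecutive cells, keeps a stack of environments, and has words that are long enough for the numbers
up to `W` and for the addresses of the pairs built so far. -/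

/-- Data: a word, or a pointer to a pair. -/
inductive Data where
  | num (k : ℕ) : Data
  | pair (a b : Data) : Data

/-- Program code. `var i` refers to the `i`-th innermost bound variable. -/
inductive Code where
  /-- the value of a variable -/
  | var (i : ℕ) : Code
  /-- a constant -/
  | num (k : ℕ) : Code
  /-- addition -/
  | add (a b : Code) : Code
  /-- truncated subtraction -/
  | sub (a b : Code) : Code
  /-- creation of a pair -/
  | pair (a b : Code) : Code
  /-- if the value of `a` is a pair, bind its two components as variables `0` and `1` and continue
  with `b`; if it is a number, continue with `c` -/
  | casePair (a b c : Code) : Code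
  /-- if the number `a` is at most the number `b`, continue with `c`, otherwise with `d` -/
  | ifLe (a b c d : Code) : Code
  /-- if the numbers `a` and `b` are equal, continue with `c`, otherwise with `d` -/
  | ifEq (a b c d : Code) : Code
  /-- bind the value of `a` as variable `0` and continue with `b` -/
  | letIn (a b : Code) : Code
  /-- call the function number `f` of the program with the argument `a` -/
  | call (f : ℕ) (a : Code) : Code

/-- A program: the list of the bodies of its functions. Each function has one argument, which is
variable `0` of its body. -/
abbrev Program := List Code

/-- `Eval P W env c d T`: in the program `P`, with words that hold the numbers up to `W`, the code `c`
evaluates to `d` in the environment `env` in exactly `T` steps. There is no evaluation if a sum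
exceeds `W` or an operation is applied to data of the wrong kind. -/
inductive Eval (P : Program) (W : ℕ) : List Data → Code → Data → ℕ → Prop where
  | var {env : List Data} {i : ℕ} {d : Data} :
      env[i]? = some d → Eval P W env (.var i) d 1
  | num {env : List Data} {k : ℕ} :
      Eval P W env (.num k) (.num k) 1
  | add {env : List Data} {a b : Code} {x y S T : ℕ} :
      Eval P W env a (.num x) S → Eval P W env b (.num y) T → x + y ≤ W →
      Eval P W env (.add a b) (.num (x + y)) (S + T + 1)
  | sub {env : List Data} {a b : Code} {x y S T : ℕ} :
      Eval P W env a (.num x) S → Eval P W env b (.num y) T →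
      Eval P W env (.sub a b) (.num (x - y)) (S + T + 1)
  | pair {env : List Data} {a b : Code} {x y : Data} {S T : ℕ} :
      Eval P W env a x S → Eval P W env b y T →
      Eval P W env (.pair a b) (.pair x y) (S + T + 1)
  | casePair_pair {env : List Data} {a b c : Code} {x y d : Data} {S T : ℕ} :
      Eval P W env a (.pair x y) S → Eval P W (x :: y :: env) b d T →
      Eval P W env (.casePair a b c) d (S + T + 1)
  | casePair_num {env : List Data} {a b c : Code} {k : ℕ} {d : Data} {S T : ℕ} :
      Eval P W env a (.num k) S → Eval P W env c d T →
      Eval P W env (.casePair a b c) d (S + T + 1)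
  | ifLe_true {env : List Data} {a b c e : Code} {x y : ℕ} {d : Data} {R S T : ℕ} :
      Eval P W env a (.num x) R → Eval P W env b (.num y) S → x ≤ y → Eval P W env c d T →
      Eval P W env (.ifLe a b c e) d (R + S + T + 1)
  | ifLe_false {env : List Data} {a b c e : Code} {x y : ℕ} {d : Data} {R S T : ℕ} :
      Eval P W env a (.num x) R → Eval P W env b (.num y) S → ¬ x ≤ y → Eval P W env e d T →
      Eval P W env (.ifLe a b c e) d (R + S + T + 1)
  | ifEq_true {env : List Data} {a b c e : Code} {x y : ℕ} {d : Data} {R S T : ℕ} :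
      Eval P W env a (.num x) R → Eval P W env b (.num y) S → x = y → Eval P W env c d T →
      Eval P W env (.ifEq a b c e) d (R + S + T + 1)
  | ifEq_false {env : List Data} {a b c e : Code} {x y : ℕ} {d : Data} {R S T : ℕ} :
      Eval P W env a (.num x) R → Eval P W env b (.num y) S → ¬ x = y → Eval P W env e d T →
      Eval P W env (.ifEq a b c e) d (R + S + T + 1)
  | letIn {env : List Data} {a b : Code} {x d : Data} {S T : ℕ} :
      Eval P W env a x S → Eval P W (x :: env) b d T →
      Eval P W env (.letIn a b) d (S + T + 1)
  | call {env : List Data} {f : ℕ} {a body : Code} {x d : Data} {S T : ℕ} :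
      Eval P W env a x S → P[f]? = some body → Eval P W [x] body d T →
      Eval P W env (.call f a) d (S + T + 1)

/-- With words that hold the numbers up to `W`, the program `P` halts on the given input after exactly
`T` steps with the given output. Its main function is the function number `0`. -/
def Program.Computes (P : Program) (W : ℕ) (input output : Data) (T : ℕ) : Prop :=
  Eval P W [input] (.call 0 (.var 0)) output T

/-- The input format: a tree is a record of the type of the root, its label, and its children. -/
def NTree.encode {n : ℕ} : NTree (Fin n) → Data
  | .leaf => .num 0
  | .introVertex v t => .pair (.num 1) (.pair (.num v) t.encode)
  | .introEdge u v t => .pair (.num 2) (.pair (.pair (.num u) (.num v)) t.encode)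
  | .forget v t => .pair (.num 3) (.pair (.num v) t.encode)
  | .join s t => .pair (.num 4) (.pair s.encode t.encode)

/-- The output format: a linked list of pairs of vertices, terminated by the number `0`. -/
def encodeEdgeList {n : ℕ} : List (Fin n × Fin n) → Data
  | [] => .num 0
  | (u, v) :: L => .pair (.pair (.num u) (.num v)) (encodeEdgeList L)

/-- The list `L` of pairs `(u, v)` lists every edge of the set `F` exactly once, as `s(u, v)`. -/
def ListsEdges {n : ℕ} (L : List (Fin n × Fin n)) (F : Set (Sym2 (Fin n))) : Prop :=
  (L.map fun e => s(e.1, e.2)).Nodup ∧ F = {e | e ∈ L.map fun e => s(e.1, e.2)}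

end LargestBond

/-! In a connected graph the bonds are exactly the edge cuts of 2-colourings whose monochromatic
edges leave exactly two components (`isBond_cut`, `IsBond.exists_cut`). So the task is to maximise
the number of bichromatic edges over all colourings with two monochromatic components, by dynamic
programming along the tree.

A partial solution for a subtree is a colouring of the vertices introduced there. Its state consists
of the colours of the bag vertices, the partition of the bag into monochromatic components, and the
number of closed components, those that no longer meet the bag. The partition is stored by giving
each bag vertex a representative in the bag. The count is capped at 3, since only the value 2
matters in the end. A table keeps one entry of largest cut for each state. States are not
normalised: the order of the records and the choice of representatives may vary. There are still
only `2 ^ O(k log k)` of them for bags of size `k`.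

Correctness has two halves: every entry comes from a colouring (`exists_describes`), and every
colouring is matched by an entry with a state representing it and at least as many edges
(`exists_mem_table`). Both rest on the effect of the five node types on a labelling by
representatives (`NTree.IsLabeling`). The only global property of tree decompositions used there is
`NTree.Proper`, which follows from the connectedness of the nodes containing a vertex
(`proper_of_preconnected`). At the root the bag is empty, so the state is just the count, and the
entry with count 2 is a maximum bond.

For the running time, each function of the program is shown to compute a list function within an
explicit bound. Solutions are trees with concatenation in constant time, so a node costs a
polynomial in the table length and `k`, and flattening the final solution is linear in the number of
nodes (`solve_returns`, `bondProgram_computes`). Arithmetic turns this into the stated bound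
(`nodeCost_le`, `exists_time_bound`). -/

namespace LargestBond

/-! ### Verification of programs -/

/-- In at most `B` steps, the function number `f` returns `y` on the argument `x`. -/
def Returns (P : Program) (W f : ℕ) (x y : Data) (B : ℕ) : Prop :=
  ∃ body T, P[f]? = some body ∧ Eval P W [x] body y T ∧ T ≤ B

/-- Case distinction on data. -/
def Data.elim (x : Data) (p : Data → Data → Prop) (q : ℕ → Prop) : Prop :=
  match x with
  | .pair a b => p a b
  | .num k => q k

/-- Weakest precondition: evaluation of the code yields a value and a number of steps with the
property `Q`. -/
def wp (P : Program) (W : ℕ) : Code → List Data → (Data → ℕ → Prop) → Prop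
  | .var i, env, Q => ∃ d, env[i]? = some d ∧ Q d 1
  | .num k, _, Q => Q (.num k) 1
  | .add a b, env, Q => wp P W a env fun x S => wp P W b env fun y T =>
      ∃ i j, x = .num i ∧ y = .num j ∧ i + j ≤ W ∧ Q (.num (i + j)) (S + T + 1)
  | .sub a b, env, Q => wp P W a env fun x S => wp P W b env fun y T =>
      ∃ i j, x = .num i ∧ y = .num j ∧ Q (.num (i - j)) (S + T + 1)
  | .pair a b, env, Q => wp P W a env fun x S => wp P W b env fun y T =>
      Q (.pair x y) (S + T + 1)
  | .casePair a b c, env, Q => wp P W a env fun x S => x.elim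
      (fun u v => wp P W b (u :: v :: env) fun d T => Q d (S + T + 1))
      (fun _ => wp P W c env fun d T => Q d (S + T + 1))
  | .ifLe a b c e, env, Q => wp P W a env fun x R => wp P W b env fun y S =>
      ∃ i j, x = .num i ∧ y = .num j ∧
        (i ≤ j → wp P W c env fun d T => Q d (R + S + T + 1)) ∧
        (¬ i ≤ j → wp P W e env fun d T => Q d (R + S + T + 1))
  | .ifEq a b c e, env, Q => wp P W a env fun x R => wp P W b env fun y S =>
      ∃ i j, x = .num i ∧ y = .num j ∧
        (i = j → wp P W c env fun d T => Q d (R + S + T + 1)) ∧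
        (¬ i = j → wp P W e env fun d T => Q d (R + S + T + 1))
  | .letIn a b, env, Q => wp P W a env fun x S => wp P W b (x :: env) fun d T => Q d (S + T + 1)
  | .call f a, env, Q => wp P W a env fun x S =>
      ∃ y B, Returns P W f x y B ∧ ∀ T ≤ B, Q y (S + T + 1)

/-- Structural induction on the code suffices, because a call is charged to a given `Returns`
statement. Recursion of the program is handled separately, by induction on the data, in the lemmas
on the individual functions. -/
theorem exists_eval_of_wp {P : Program} {W : ℕ} {c : Code} {env : List Data}
    {Q : Data → ℕ → Prop} (h : wp P W c env Q) : ∃ d T, Eval P W env c d T ∧ Q d T := by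
  induction c generalizing env Q with
  | var i => obtain ⟨d, hd, hQ⟩ := h; exact ⟨d, 1, .var hd, hQ⟩
  | num k => exact ⟨_, 1, .num, h⟩
  | add a b iha ihb =>
    obtain ⟨x, S, ha, h⟩ := iha h
    obtain ⟨y, T, hb, i, j, rfl, rfl, hW, hQ⟩ := ihb h
    exact ⟨_, _, .add ha hb hW, hQ⟩
  | sub a b iha ihb =>
    obtain ⟨x, S, ha, h⟩ := iha h
    obtain ⟨y, T, hb, i, j, rfl, rfl, hQ⟩ := ihb h
    exact ⟨_, _, .sub ha hb, hQ⟩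
  | pair a b iha ihb =>
    obtain ⟨x, S, ha, h⟩ := iha h
    obtain ⟨y, T, hb, hQ⟩ := ihb h
    exact ⟨_, _, .pair ha hb, hQ⟩
  | casePair a b c iha ihb ihc =>
    obtain ⟨x, S, ha, h⟩ := iha h
    cases x with
    | num k =>
      obtain ⟨d, T, hc, hQ⟩ := ihc h
      exact ⟨_, _, .casePair_num ha hc, hQ⟩
    | pair u v =>
      obtain ⟨d, T, hb, hQ⟩ := ihb h
      exact ⟨_, _, .casePair_pair ha hb, hQ⟩
  | ifLe a b c e iha ihb ihc ihe =>
    obtain ⟨x, R, ha, h⟩ := iha h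
    obtain ⟨y, S, hb, i, j, rfl, rfl, h1, h2⟩ := ihb h
    by_cases hij : i ≤ j
    · obtain ⟨d, T, hc, hQ⟩ := ihc (h1 hij)
      exact ⟨_, _, .ifLe_true ha hb hij hc, hQ⟩
    · obtain ⟨d, T, hc, hQ⟩ := ihe (h2 hij)
      exact ⟨_, _, .ifLe_false ha hb hij hc, hQ⟩
  | ifEq a b c e iha ihb ihc ihe =>
    obtain ⟨x, R, ha, h⟩ := iha h
    obtain ⟨y, S, hb, i, j, rfl, rfl, h1, h2⟩ := ihb h
    by_cases hij : i = j
    · obtain ⟨d, T, hc, hQ⟩ := ihc (h1 hij)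
      exact ⟨_, _, .ifEq_true ha hb hij hc, hQ⟩
    · obtain ⟨d, T, hc, hQ⟩ := ihe (h2 hij)
      exact ⟨_, _, .ifEq_false ha hb hij hc, hQ⟩
  | letIn a b iha ihb =>
    obtain ⟨x, S, ha, h⟩ := iha h
    obtain ⟨y, T, hb, hQ⟩ := ihb h
    exact ⟨_, _, .letIn ha hb, hQ⟩
  | call f a iha =>
    obtain ⟨x, S, ha, y, B, ⟨body, T, hf, hb, hT⟩, hQ⟩ := iha h
    exact ⟨_, _, .call ha hf hb, hQ T hT⟩

theorem Returns.of_wp {P : Program} {W f : ℕ} {x y : Data} {B : ℕ} {body : Code}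
    (hf : P[f]? = some body) (h : wp P W body [x] fun d T => d = y ∧ T ≤ B) :
    Returns P W f x y B := by
  obtain ⟨d, T, he, rfl, hT⟩ := exists_eval_of_wp h
  exact ⟨body, T, hf, he, hT⟩

theorem Returns.mono {P : Program} {W f : ℕ} {x y : Data} {B B' : ℕ}
    (h : Returns P W f x y B) (hB : B ≤ B') : Returns P W f x y B' := by
  obtain ⟨body, T, hf, he, hT⟩ := h
  exact ⟨body, T, hf, he, hT.trans hB⟩

/-! ### The program -/

namespace Prog

open Code

/-- Main function: a maximum bond of the graph with the given nice tree decomposition. -/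
def main : Code := call 12 (pair (call 13 (call 1 (var 0))) (num 0))

/-- The table of a tree. -/
def solve : Code :=
  casePair (var 0)
    (casePair (var 1)
      (ifEq (var 2) (num 4)
        (call 2 (pair (pair (num 4) (call 1 (var 1))) (pair (call 1 (var 0)) (num 0))))
        (call 2 (pair (pair (var 2) (var 0)) (pair (call 1 (var 1)) (num 0)))))
      (num 0))
    (pair (pair (pair (num 0) (num 0)) (pair (num 0) (num 0))) (num 0))

/-- Update of an accumulator with all the entries of a table, by the operation `op`. -/
def loop : Code :=
  casePair (var 0)
    (casePair (var 1)
      (casePair (var 0)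
        (call 3 (pair (var 4) (pair (var 0) (call 2 (pair (var 4) (pair (var 1) (var 3)))))))
        (var 1))
      (num 0))
    (num 0)

/-- Dispatch of the operations. -/
def step : Code :=
  casePair (var 0)
    (casePair (var 0)
      (ifEq (var 0) (num 1) (call 14 (pair (var 1) (var 3)))
        (ifEq (var 0) (num 2) (call 15 (pair (var 1) (var 3)))
          (ifEq (var 0) (num 3) (call 16 (pair (var 1) (var 3)))
            (ifEq (var 0) (num 4) (call 17 (pair (var 1) (var 3)))
              (call 18 (pair (var 1) (var 3)))))))
      (num 0))
    (num 0)

/-- Insertion of an entry into a table, which keeps the better one of two entries with the same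
key. -/
def insert : Code :=
  casePair (var 0)
    (casePair (var 1)
      (casePair (var 0)
        (casePair (var 4)
          (ifEq (call 5 (pair (var 0) (var 2))) (num 1)
            (casePair (var 1)
              (casePair (var 5)
                (ifLe (var 0) (var 2) (pair (var 10) (var 9)) (pair (var 8) (var 9)))
                (num 0))
              (num 0))
            (pair (var 4) (call 4 (pair (var 6) (var 5)))))
          (num 0))
        (num 0))
      (pair (var 0) (num 0)))
    (num 0)

/-- Equality of data. -/
def eq : Code :=
  casePair (var 0)
    (casePair (var 0)
      (casePair (var 3)
        (ifEq (call 5 (pair (var 2) (var 0))) (num 1) (call 5 (pair (var 3) (var 1))) (num 0))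
        (num 0))
      (casePair (var 1) (num 0) (ifEq (var 0) (var 1) (num 1) (num 0))))
    (num 0)

/-- Colour and label of a vertex. -/
def lookup : Code :=
  casePair (var 0)
    (casePair (var 1)
      (casePair (var 0)
        (ifEq (var 0) (var 4) (var 1) (call 6 (pair (var 4) (var 3))))
        (num 0))
      (pair (num 0) (num 0)))
    (num 0)

/-- Replacement of a label by another one. -/
def rename : Code :=
  casePair (var 0)
    (casePair (var 1)
      (casePair (var 0)
        (casePair (var 1)
          (pair
            (pair (var 2) (pair (var 0)
              (casePair (var 6) (ifEq (var 3) (var 0) (var 1) (var 3)) (num 0))))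
            (call 7 (pair (var 6) (var 5))))
          (num 0))
        (num 0))
      (num 0))
    (num 0)

/-- Removal of a vertex. -/
def erase : Code :=
  casePair (var 0)
    (casePair (var 1)
      (casePair (var 0)
        (ifEq (var 0) (var 4) (call 8 (pair (var 4) (var 3)))
          (pair (var 2) (call 8 (pair (var 4) (var 3)))))
        (num 0))
      (num 0))
    (num 0)

/-- A vertex with a given label. -/
def findLabel : Code :=
  casePair (var 0)
    (casePair (var 1)
      (casePair (var 0)
        (casePair (var 1)
          (ifEq (var 1) (var 6) (pair (var 2) (num 0)) (call 9 (pair (var 6) (var 5))))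
          (num 0))
        (num 0))
      (num 0))
    (num 0)

/-- Union of the blocks of two vertices. -/
def unite : Code :=
  casePair (var 0)
    (casePair (var 0)
      (call 7 (pair
        (pair (casePair (call 6 (pair (var 0) (var 3))) (var 1) (num 0))
          (casePair (call 6 (pair (var 1) (var 3))) (var 1) (num 0)))
        (var 3)))
      (num 0))
    (num 0)

/-- Common coarsening of two partitions. -/
def merge : Code :=
  casePair (var 0)
    (casePair (var 0)
      (casePair (var 0)
        (casePair (var 1)
          (call 10 (pair (var 5) (call 19 (pair (pair (var 2) (var 1)) (var 7)))))
          (num 0))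
        (num 0))
      (var 1))
    (num 0)

/-- Equality of two colourings of a bag. -/
def agree : Code :=
  casePair (var 0)
    (casePair (var 0)
      (casePair (var 0)
        (casePair (var 1)
          (ifEq (casePair (call 6 (pair (var 2) (var 7))) (var 0) (num 0)) (var 0)
            (call 11 (pair (var 5) (var 7)))
            (num 0))
          (num 0))
        (num 0))
      (num 1))
    (num 0)

/-- The list of the edges of a solution, followed by another list. -/
def flatten : Code :=
  casePair (var 0)
    (casePair (var 0)
      (casePair (var 0)
        (pair (var 2) (call 12 (pair (var 3) (var 5))))
        (casePair (var 1)
          (call 12 (pair (var 0) (call 12 (pair (var 1) (var 5)))))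
          (num 0)))
      (var 1))
    (num 0)

/-- The solution of the first entry with two closed components. -/
def pick : Code :=
  casePair (var 0)
    (casePair (var 0)
      (casePair (var 0)
        (ifEq (var 0) (num 2)
          (casePair (var 3) (var 1) (num 0))
          (call 13 (var 5)))
        (num 0))
      (num 0))
    (num 0)

/-- Extension of an entry by a vertex of colour `c`. -/
def extend (c : ℕ) : Code :=
  pair (pair (var 0) (pair (pair (var 6) (pair (num c) (var 6))) (var 1))) (var 3)

/-- The operation of an introduce vertex node. -/
def introVertex : Code :=
  casePair (var 0)
    (casePair (var 1)
      (casePair (var 0)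
        (casePair (var 0)
          (call 4 (pair (extend 0) (call 4 (pair (extend 1) (var 5)))))
          (num 0))
        (num 0))
      (num 0))
    (num 0)

/-- The operation of an introduce edge node. -/
def introEdge : Code :=
  casePair (var 0)
    (casePair (var 1)
      (casePair (var 0)
        (casePair (var 0)
          (casePair (var 6)
            (ifEq (casePair (call 6 (pair (var 0) (var 3))) (var 0) (num 0))
              (casePair (call 6 (pair (var 1) (var 3))) (var 0) (num 0))
              (call 4 (pair
                (pair (pair (var 2) (call 19 (pair (pair (var 0) (var 1)) (var 3)))) (var 5))
                (var 7)))
              (casePair (var 5)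
                (call 4 (pair
                  (pair (var 6) (pair (add (var 0) (num 1)) (pair (var 10) (var 1))))
                  (var 9)))
                (num 0)))
            (num 0))
          (num 0))
        (num 0))
      (num 0))
    (num 0)

/-- The number of closed components, capped. -/
def cap (c : Code) : Code := letIn c (ifLe (num 3) (var 0) (num 3) (var 0))

/-- The operation of a forget node. -/
def forget : Code :=
  casePair (var 0)
    (casePair (var 1)
      (casePair (var 0)
        (casePair (var 0)
          (letIn (call 8 (pair (var 6) (var 1)))
            (casePair
              (call 9 (pair (casePair (call 6 (pair (var 7) (var 2))) (var 1) (num 0)) (var 0)))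
              (call 4 (pair
                (pair
                  (pair (var 3) (call 7 (pair
                    (pair (casePair (call 6 (pair (var 9) (var 4))) (var 1) (num 0)) (var 0))
                    (var 2))))
                  (var 6))
                (var 8)))
              (call 4 (pair (pair (pair (cap (add (var 1) (num 1))) (var 0)) (var 4)) (var 6)))))
          (num 0))
        (num 0))
      (num 0))
    (num 0)

/-- The combinations of an entry of the left child of a join node with the right table. -/
def joinRow : Code :=
  casePair (var 0)
    (casePair (var 1)
      (call 2 (pair (pair (num 5) (var 0)) (pair (var 2) (var 1))))
      (num 0))
    (num 0)

/-- The combination of two entries at a join node. -/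
def join : Code :=
  casePair (var 0)
    (casePair (var 1)
      (casePair (var 0)
        (casePair (var 0)
          (casePair (var 6)
            (casePair (var 0)
              (ifEq (call 11 (pair (var 5) (var 1))) (num 1)
                (casePair (var 3)
                  (casePair (var 9)
                    (call 4 (pair
                      (pair
                        (pair (cap (add (var 4) (var 8))) (call 10 (pair (var 9) (var 5))))
                        (pair (add (var 2) (var 0)) (pair (num 0) (pair (var 3) (var 1)))))
                      (var 13)))
                    (num 0))
                  (num 0))
                (var 9))
              (num 0))
            (num 0))
          (num 0))
        (num 0))
      (num 0))
    (num 0)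

end Prog

/-- The program that finds maximum bonds. -/
def bondProgram : Program :=
  [Prog.main, Prog.solve, Prog.loop, Prog.step, Prog.insert, Prog.eq, Prog.lookup, Prog.rename,
    Prog.erase, Prog.findLabel, Prog.merge, Prog.agree, Prog.flatten, Prog.pick, Prog.introVertex,
    Prog.introEdge, Prog.forget, Prog.joinRow, Prog.join, Prog.unite]

/-! ### The data of the dynamic program -/

/-- A vertex of the bag with its colour and the label of its component. -/
abbrev Rec := ℕ × ℕ × ℕ

/-- The capped number of closed components, and the records of the vertices of the bag. -/
abbrev State := ℕ × List Rec

/-- Lists of edges with concatenation in constant time. -/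
inductive Sol where
  | nil : Sol
  | edge (u v : ℕ) (s : Sol) : Sol
  | join (s t : Sol) : Sol

namespace Sol

/-- The list of the edges of a solution. -/
def toList : Sol → List (ℕ × ℕ)
  | nil => []
  | edge u v s => (u, v) :: s.toList
  | join s t => s.toList ++ t.toList

/-- The number of nodes of a solution. -/
def size : Sol → ℕ
  | nil => 1
  | edge _ _ s => s.size + 1
  | join s t => s.size + t.size + 1

/-- Solutions as data. -/
def encode : Sol → Data
  | nil => .num 0
  | edge u v s => .pair (.pair (.num u) (.num v)) s.encode
  | join s t => .pair (.num 0) (.pair s.encode t.encode)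

end Sol

/-- A partial solution: its state, its number of edges, and its edges. -/
abbrev Entry := State × ℕ × Sol

/-- Lists as data. -/
def encodeList {α : Type*} (f : α → Data) : List α → Data
  | [] => .num 0
  | a :: L => .pair (f a) (encodeList f L)

/-- Records as data. -/
def encodeRec (r : Rec) : Data := .pair (.num r.1) (.pair (.num r.2.1) (.num r.2.2))

/-- Lists of records as data. -/
abbrev encodeRecs : List Rec → Data := encodeList encodeRec

/-- States as data. -/
def encodeState (s : State) : Data := .pair (.num s.1) (encodeRecs s.2)

/-- Entries as data. -/
def encodeEntry (e : Entry) : Data := .pair (encodeState e.1) (.pair (.num e.2.1) e.2.2.encode)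

/-- Tables as data. -/
abbrev encodeTable : List Entry → Data := encodeList encodeEntry

/-- Pairs of numbers as data. -/
def encodePair (p : ℕ × ℕ) : Data := .pair (.num p.1) (.num p.2)

/-- Colour and label of a vertex. -/
def lookup (v : ℕ) : List Rec → ℕ × ℕ
  | [] => (0, 0)
  | r :: L => if r.1 = v then r.2 else lookup v L

/-- Replacement of the label `a` by `b`. -/
def rename (a b : ℕ) : List Rec → List Rec :=
  List.map fun r => (r.1, r.2.1, if r.2.2 = a then b else r.2.2)

/-- Removal of a vertex. -/
def eraseVertex (v : ℕ) : List Rec → List Rec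
  | [] => []
  | r :: L => if r.1 = v then eraseVertex v L else r :: eraseVertex v L

/-- A vertex with label `l`. -/
def findLabel (l : ℕ) : List Rec → Option ℕ
  | [] => none
  | r :: L => if r.2.2 = l then some r.1 else findLabel l L

/-- Union of the blocks of two vertices. -/
def unite (u v : ℕ) (L : List Rec) : List Rec := rename (lookup u L).2 (lookup v L).2 L

/-- Common coarsening of two partitions. -/
def merge : List Rec → List Rec → List Rec
  | [], L => L
  | r :: K, L => merge K (unite r.1 r.2.2 L)

/-- The vertices of the first list have the same colours in the second one. -/
def agree : List Rec → List Rec → Bool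
  | [], _ => true
  | r :: K, L => if (lookup r.1 L).1 = r.2.1 then agree K L else false

/-- Insertion of an entry into a table. -/
def insertEntry (e : Entry) : List Entry → List Entry
  | [] => [e]
  | h :: T => if e.1 = h.1 then (if h.2.1 ≤ e.2.1 then e :: T else h :: T) else h :: insertEntry e T

/-- Extension of an entry by an isolated vertex. -/
def extendEntry (v c : ℕ) (e : Entry) : Entry := ((e.1.1, (v, c, v) :: e.1.2), e.2)

/-- Extension of an entry by an edge. -/
def edgeEntry (u v : ℕ) (e : Entry) : Entry :=
  if (lookup u e.1.2).1 = (lookup v e.1.2).1 then ((e.1.1, unite u v e.1.2), e.2)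
  else (e.1, e.2.1 + 1, .edge u v e.2.2)

/-- The state after a vertex is forgotten. -/
def forgetState (v : ℕ) (s : State) : State :=
  match findLabel (lookup v s.2).2 (eraseVertex v s.2) with
  | some u => (s.1, rename (lookup v s.2).2 u (eraseVertex v s.2))
  | none => (min 3 (s.1 + 1), eraseVertex v s.2)

/-- Combination of two entries. -/
def joinEntry (e f : Entry) : Entry :=
  ((min 3 (e.1.1 + f.1.1), merge f.1.2 e.1.2), e.2.1 + f.2.1, .join e.2.2 f.2.2)

/-- The solution of the first entry with two closed components. -/
def pick : List Entry → Sol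
  | [] => .nil
  | e :: T => if e.1.1 = 2 then e.2.2 else pick T

/-- The operation of an introduce vertex node. -/
def stepVertex (v : ℕ) (e : Entry) (acc : List Entry) : List Entry :=
  insertEntry (extendEntry v 0 e) (insertEntry (extendEntry v 1 e) acc)

/-- The operation of an introduce edge node. -/
def stepEdge (u v : ℕ) (e : Entry) (acc : List Entry) : List Entry :=
  insertEntry (edgeEntry u v e) acc

/-- The operation of a forget node. -/
def stepForget (v : ℕ) (e : Entry) (acc : List Entry) : List Entry :=
  insertEntry (forgetState v e.1, e.2) acc

/-- The combination of two entries at a join node. -/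
def stepJoin (e f : Entry) (acc : List Entry) : List Entry :=
  if agree f.1.2 e.1.2 then insertEntry (joinEntry e f) acc else acc

/-- The table of a tree. -/
def table {n : ℕ} : NTree (Fin n) → List Entry
  | .leaf => [((0, []), 0, .nil)]
  | .introVertex v t => (table t).foldr (stepVertex v) []
  | .introEdge u v t => (table t).foldr (stepEdge u v) []
  | .forget v t => (table t).foldr (stepForget v) []
  | .join s t => (table s).foldr (fun e acc => (table t).foldr (stepJoin e) acc) []

end LargestBond

namespace LargestBond

/-! ### Running times of the functions -/

attribute [local simp ↓] wp
attribute [local simp] Data.elim encodeList encodeRec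

/-- The number of words and pairs of a piece of data. -/
def Data.size : Data → ℕ
  | .num _ => 1
  | .pair a b => a.size + b.size + 1

/-- The two arguments are traversed in parallel up to the first mismatch, so the size of the first
alone bounds the cost. -/
theorem eq_returns {W : ℕ} (x y : Data) [Decidable (x = y)] :
    Returns bondProgram W 5 (.pair x y) (.num (if x = y then 1 else 0)) (20 * x.size) := by
  classical
  induction x generalizing y with
  | num k =>
    refine .of_wp rfl ?_
    cases y <;> simp [Prog.eq, Data.size]
  | pair a b iha ihb =>
    refine .of_wp rfl ?_
    cases y with
    | num l =>
      simp [Prog.eq, Data.size]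
      omega
    | pair c d =>
      simp only [Prog.eq, Data.size, wp, Data.elim, List.getElem?_cons_zero,
        List.getElem?_cons_succ, Option.some.injEq, exists_eq_left']
      refine ⟨_, _, iha c, fun T hT => ⟨_, _, rfl, rfl, fun h => ⟨_, _, ihb d, fun S hS => ?_⟩,
        fun h => ?_⟩⟩
      · obtain rfl : a = c := by simpa using h
        simp only [Data.pair.injEq, true_and]
        omega
      · have h : a ≠ c := by simpa using h
        simp only [h, Data.pair.injEq, false_and, if_false, true_and]
        omega

theorem lookup_returns {W : ℕ} (v : ℕ) (L : List Rec) :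
    Returns bondProgram W 6 (.pair (.num v) (encodeRecs L))
      (.pair (.num (lookup v L).1) (.num (lookup v L).2)) (20 * L.length + 10) := by
  induction L with
  | nil => exact .of_wp rfl (by simp [Prog.lookup, lookup])
  | cons r L ih =>
    refine .of_wp rfl ?_
    simp [Prog.lookup, lookup]
    refine ⟨fun h => ?_, fun h => ⟨_, _, ih, fun T hT => ?_⟩⟩
    · simp [h]
    · simp [h]; omega

theorem rename_returns {W : ℕ} (a b : ℕ) (L : List Rec) :
    Returns bondProgram W 7 (.pair (.pair (.num a) (.num b)) (encodeRecs L))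
      (encodeRecs (rename a b L)) (40 * L.length + 10) := by
  induction L with
  | nil => exact .of_wp rfl (by simp [Prog.rename, rename])
  | cons r L ih =>
    refine .of_wp rfl ?_
    simp [Prog.rename, rename]
    refine ⟨fun h => ⟨_, _, ih, fun T hT => ?_⟩, fun h => ⟨_, _, ih, fun T hT => ?_⟩⟩
    · simp [h, rename]; omega
    · simp [h, rename]; omega

theorem erase_returns {W : ℕ} (v : ℕ) (L : List Rec) :
    Returns bondProgram W 8 (.pair (.num v) (encodeRecs L))
      (encodeRecs (eraseVertex v L)) (30 * L.length + 10) := by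
  induction L with
  | nil => exact .of_wp rfl (by simp [Prog.erase, eraseVertex])
  | cons r L ih =>
    refine .of_wp rfl ?_
    simp [Prog.erase, eraseVertex]
    refine ⟨fun h => ⟨_, _, ih, fun T hT => ?_⟩, fun h => ⟨_, _, ih, fun T hT => ?_⟩⟩
    · simp [h]; omega
    · simp [h]; omega

theorem findLabel_returns {W : ℕ} (l : ℕ) (L : List Rec) :
    Returns bondProgram W 9 (.pair (.num l) (encodeRecs L))
      ((findLabel l L).elim (.num 0) fun u => .pair (.num u) (.num 0)) (30 * L.length + 10) := by
  induction L with
  | nil => exact .of_wp rfl (by simp [Prog.findLabel, findLabel])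
  | cons r L ih =>
    refine .of_wp rfl ?_
    simp [Prog.findLabel, findLabel]
    refine ⟨fun h => ?_, fun h => ⟨_, _, ih, fun T hT => ?_⟩⟩
    · simp [h]; omega
    · simp [h]; omega

theorem unite_returns {W : ℕ} (u v : ℕ) (L : List Rec) :
    Returns bondProgram W 19 (.pair (.pair (.num u) (.num v)) (encodeRecs L))
      (encodeRecs (unite u v L)) (80 * L.length + 70) := by
  refine .of_wp rfl ?_
  simp [Prog.unite]
  refine ⟨_, _, lookup_returns u L, fun S hS => ?_⟩
  simp
  refine ⟨_, _, lookup_returns v L, fun T hT => ?_⟩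
  simp
  refine ⟨_, _, rename_returns _ _ L, fun R hR => ⟨rfl, ?_⟩⟩
  omega

@[simp]
theorem length_rename (a b : ℕ) (L : List Rec) : (rename a b L).length = L.length := by
  simp [rename]

@[simp]
theorem length_unite (u v : ℕ) (L : List Rec) : (unite u v L).length = L.length := by
  simp [unite]

theorem merge_returns {W : ℕ} (K L : List Rec) :
    Returns bondProgram W 10 (.pair (encodeRecs K) (encodeRecs L))
      (encodeRecs (merge K L)) (K.length * (80 * L.length + 110) + 10) := by
  induction K generalizing L with
  | nil => exact .of_wp rfl (by simp [Prog.merge, merge])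
  | cons r K ih =>
    refine .of_wp rfl ?_
    simp [Prog.merge, merge]
    refine ⟨_, _, unite_returns _ _ L, fun S hS => ⟨_, _, ih _, fun T hT => ⟨rfl, ?_⟩⟩⟩
    simp only [length_unite] at hT
    rw [Nat.succ_mul]
    omega

theorem agree_returns {W : ℕ} (K L : List Rec) :
    Returns bondProgram W 11 (.pair (encodeRecs K) (encodeRecs L))
      (.num (if agree K L then 1 else 0)) (K.length * (20 * L.length + 50) + 10) := by
  induction K with
  | nil => exact .of_wp rfl (by simp [Prog.agree, agree])
  | cons r K ih =>
    refine .of_wp rfl ?_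
    simp [Prog.agree, agree]
    refine ⟨_, _, lookup_returns _ L, fun S hS => ?_⟩
    simp [Nat.add_mul]
    refine ⟨fun h => ⟨_, _, ih, fun T hT => ?_⟩, fun h => ?_⟩
    · simp [h]; omega
    · simp [h]; omega

/-- `L` is an accumulator that is never copied, so its length does not enter the bound. -/
theorem flatten_returns {W : ℕ} (s : Sol) (L : List (ℕ × ℕ)) :
    Returns bondProgram W 12 (.pair s.encode (encodeList encodePair L))
      (encodeList encodePair (s.toList ++ L)) (30 * s.size) := by
  induction s generalizing L with
  | nil => exact .of_wp rfl (by simp [Prog.flatten, Sol.encode, Sol.toList, Sol.size])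
  | edge u v s ih =>
    refine .of_wp rfl ?_
    simp [Prog.flatten, Sol.encode, Sol.toList, Sol.size]
    refine ⟨_, _, ih L, fun T hT => ⟨by simp [encodePair], ?_⟩⟩
    omega
  | join s t ihs iht =>
    refine .of_wp rfl ?_
    simp [Prog.flatten, Sol.encode, Sol.toList, Sol.size]
    refine ⟨_, _, iht L, fun T hT => ⟨_, _, ihs _, fun S hS => ⟨by simp, ?_⟩⟩⟩
    omega

theorem pick_returns {W : ℕ} (A : List Entry) :
    Returns bondProgram W 13 (encodeTable A) (pick A).encode (20 * A.length + 10) := by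
  induction A with
  | nil => exact .of_wp rfl (by simp [Prog.pick, pick, Sol.encode])
  | cons e A ih =>
    refine .of_wp rfl ?_
    simp [Prog.pick, pick, encodeEntry, encodeState]
    refine ⟨fun h => ?_, fun h => ⟨_, _, ih, fun T hT => ?_⟩⟩
    · simp [h]; omega
    · simp [h]; omega

/-- Needed because the program tests equality of data while `insertEntry` tests equality of states.
-/
theorem encodeRecs_injective : Function.Injective encodeRecs := by
  intro K L h
  induction K generalizing L with
  | nil => cases L <;> simp_all
  | cons r K ih =>
    cases L with
    | nil => simp at h
    | cons s L =>
      simp only [encodeList, encodeRec, Data.pair.injEq, Data.num.injEq] at h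
      rw [ih h.2, Prod.ext h.1.1 (Prod.ext h.1.2.1 h.1.2.2)]

theorem encodeState_inj {s t : State} : encodeState s = encodeState t ↔ s = t := by
  constructor
  · intro h
    simp only [encodeState, Data.pair.injEq, Data.num.injEq] at h
    exact Prod.ext h.1 (encodeRecs_injective h.2)
  · rintro rfl
    rfl

theorem size_encodeRecs (L : List Rec) : (encodeRecs L).size = 6 * L.length + 1 := by
  induction L with
  | nil => rfl
  | cons r L ih =>
    change (encodeRec r).size + (encodeRecs L).size + 1 = _
    simp only [ih, encodeRec, Data.size, List.length_cons]
    omega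

theorem size_encodeState (s : State) : (encodeState s).size = 6 * s.2.length + 3 := by
  simp only [encodeState, Data.size, size_encodeRecs]
  omega

/-- Linear search. A record contributes 6 to the size of a key and the comparison costs 20 per unit
of size, whence the coefficient 120. -/
theorem insert_returns {W : ℕ} (e : Entry) (A : List Entry) :
    Returns bondProgram W 4 (.pair (encodeEntry e) (encodeTable A))
      (encodeTable (insertEntry e A)) (A.length * (120 * e.1.2.length + 110) + 10) := by
  classical
  induction A with
  | nil => exact .of_wp rfl (by simp [Prog.insert, insertEntry])
  | cons h A ih =>
    refine .of_wp rfl ?_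
    simp [Prog.insert, insertEntry]
    simp only [encodeEntry]
    refine ⟨_, _, eq_returns _ _, fun T hT => ?_⟩
    simp only [size_encodeState] at hT
    simp only [encodeState_inj, Nat.add_mul, Nat.one_mul]
    simp
    refine ⟨fun hk => ⟨fun hv => ?_, fun hv => ?_⟩, fun hk => ⟨_, _, ih, fun S hS => ?_⟩⟩
    · rw [hk] at hT
      simp [hk, hv, encodeEntry]; omega
    · rw [hk] at hT
      simp [hk, hv.not_ge, encodeEntry]; omega
    · simp [hk, encodeEntry]; omega

end LargestBond

/-! ### Running times of the operations at the nodes -/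

namespace LargestBond

attribute [local simp ↓] wp
attribute [local simp] Data.elim encodeList encodeRec

/-- Bound for the running time of an operation on entries with at most `k` records that are inserted
into tables with fewer than `B` entries. -/
def opCost (B k : ℕ) : ℕ := 2 * (B * (120 * k + 110)) + k * (200 * k + 500) + 300

theorem insert_returns_le {W B k : ℕ} {e : Entry} {A : List Entry}
    (hk : e.1.2.length ≤ k) (hA : A.length ≤ B) :
    Returns bondProgram W 4 (.pair (encodeEntry e) (encodeTable A))
      (encodeTable (insertEntry e A)) (B * (120 * k + 110) + 10) :=
  (insert_returns e A).mono (by gcongr)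

theorem length_insertEntry_le (e : Entry) (A : List Entry) :
    (insertEntry e A).length ≤ A.length + 1 := by
  induction A with
  | nil => simp [insertEntry]
  | cons h A ih =>
    unfold insertEntry
    split_ifs <;> simp only [List.length_cons] <;> omega

theorem introVertex_returns {W B k : ℕ} (v : ℕ) {e : Entry} {A : List Entry}
    (hk : e.1.2.length + 1 ≤ k) (hA : A.length < B) :
    Returns bondProgram W 14 (.pair (.num v) (.pair (encodeEntry e) (encodeTable A)))
      (encodeTable (stepVertex v e A)) (opCost B k) := by
  refine .of_wp rfl ?_
  simp only [Prog.introVertex, Prog.extend, wp, Data.elim, List.getElem?_cons_zero,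
    List.getElem?_cons_succ, Option.some.injEq, exists_eq_left', encodeEntry, encodeState]
  -- The second insertion may meet a table with one more entry, which is why `A.length < B` is
  -- strict; the two insertions account for the factor 2 in `opCost`.
  refine ⟨_, _, insert_returns_le (e := extendEntry v 1 e) (k := k) hk hA.le, fun S hS =>
    ⟨_, _, insert_returns_le (e := extendEntry v 0 e) (k := k) (B := B) hk
      ((length_insertEntry_le _ _).trans hA), fun T hT => ⟨rfl, ?_⟩⟩⟩
  unfold opCost
  omega

theorem introEdge_returns {W B k : ℕ} (u v : ℕ) {e : Entry} {A : List Entry}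
    (hk : e.1.2.length ≤ k) (hA : A.length < B) (hW : e.2.1 + 1 ≤ W) :
    Returns bondProgram W 15
      (.pair (.pair (.num u) (.num v)) (.pair (encodeEntry e) (encodeTable A)))
      (encodeTable (stepEdge u v e A)) (opCost B k) := by
  have hl : 20 * e.1.2.length ≤ 20 * k := by omega
  refine .of_wp rfl ?_
  simp only [Prog.introEdge, wp, Data.elim, List.getElem?_cons_zero,
    List.getElem?_cons_succ, Option.some.injEq, exists_eq_left', encodeEntry, encodeState]
  refine ⟨_, _, lookup_returns u _, fun R hR => ⟨_, _, lookup_returns v _, fun S hS =>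
    ⟨_, _, rfl, rfl, fun h => ?_, fun h => ?_⟩⟩⟩
  · refine ⟨_, _, unite_returns u v _, fun T hT => ⟨_, _, insert_returns_le
      (e := ((e.1.1, unite u v e.1.2), e.2)) (k := k) (by simpa using hk) hA.le,
      fun U hU => ⟨?_, ?_⟩⟩⟩
    · rw [stepEdge, edgeEntry, if_pos h]
    · rw [opCost, Nat.mul_add k]
      omega
  · refine ⟨_, _, rfl, rfl, hW, _, _, insert_returns_le
      (e := (e.1, e.2.1 + 1, .edge u v e.2.2)) (k := k) hk hA.le, fun U hU => ⟨?_, ?_⟩⟩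
    · rw [stepEdge, edgeEntry, if_neg h]
    · rw [opCost, Nat.mul_add k]
      omega

theorem length_eraseVertex_le (v : ℕ) (L : List Rec) : (eraseVertex v L).length ≤ L.length := by
  induction L with
  | nil => simp [eraseVertex]
  | cons r L ih =>
    unfold eraseVertex
    split_ifs <;> simp only [List.length_cons] <;> omega

theorem forget_returns {W B k : ℕ} (v : ℕ) {e : Entry} {A : List Entry}
    (hk : e.1.2.length ≤ k) (hA : A.length < B) (hW : e.1.1 + 1 ≤ W) :
    Returns bondProgram W 16 (.pair (.num v) (.pair (encodeEntry e) (encodeTable A)))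
      (encodeTable (stepForget v e A)) (opCost B k) := by
  have hl := (length_eraseVertex_le v e.1.2).trans hk
  refine .of_wp rfl ?_
  simp only [Prog.forget, Prog.cap, wp, Data.elim, List.getElem?_cons_zero,
    List.getElem?_cons_succ, Option.some.injEq, exists_eq_left', encodeEntry, encodeState]
  refine ⟨_, _, erase_returns v _, fun R hR => ⟨_, _, lookup_returns v _, fun S hS =>
    ⟨_, _, findLabel_returns _ _, fun T hT => ?_⟩⟩⟩
  cases hf : findLabel (lookup v e.1.2).2 (eraseVertex v e.1.2) with
  | some u =>
    refine ⟨_, _, lookup_returns v _, fun S' hS' => ⟨_, _, rename_returns _ _ _, fun U hU =>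
      ⟨_, _, insert_returns_le (e := ((e.1.1, rename (lookup v e.1.2).2 u (eraseVertex v e.1.2)),
        e.2)) (k := k) (by simpa using hl) hA.le, fun V hV => ⟨?_, ?_⟩⟩⟩⟩
    · simp only [stepForget, forgetState, hf]
    · rw [opCost, Nat.mul_add k]
      omega
  | none =>
    refine ⟨_, _, rfl, rfl, hW, _, _, rfl, rfl, fun h => ?_, fun h => ?_⟩
    · refine ⟨_, _, insert_returns_le (e := ((3, eraseVertex v e.1.2), e.2)) (k := k) hl hA.le,
        fun U hU => ⟨?_, ?_⟩⟩
      · simp only [stepForget, forgetState, hf, min_eq_left h]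
      · rw [opCost, Nat.mul_add k]
        omega
    · refine ⟨_, _, insert_returns_le (e := ((e.1.1 + 1, eraseVertex v e.1.2), e.2)) (k := k) hl
        hA.le, fun U hU => ⟨?_, ?_⟩⟩
      · simp only [stepForget, forgetState, hf, min_eq_right (not_le.1 h).le]
      · rw [opCost, Nat.mul_add k]
        omega

@[simp]
theorem length_merge (K L : List Rec) : (merge K L).length = L.length := by
  induction K generalizing L with
  | nil => rfl
  | cons r K ih => simp [merge, ih]

theorem join_returns {W B k : ℕ} {e f : Entry} {A : List Entry}
    (he : e.1.2.length ≤ k) (hf : f.1.2.length ≤ k) (hA : A.length < B)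
    (hc : e.1.1 + f.1.1 ≤ W) (hv : e.2.1 + f.2.1 ≤ W) :
    Returns bondProgram W 18 (.pair (encodeEntry e) (.pair (encodeEntry f) (encodeTable A)))
      (encodeTable (stepJoin e f A)) (opCost B k) := by
  have h1 : f.1.2.length * (20 * e.1.2.length + 50) ≤ k * (20 * k + 50) := by gcongr
  have h2 : f.1.2.length * (80 * e.1.2.length + 110) ≤ k * (80 * k + 110) := by gcongr
  -- The quadratic part of `opCost` pays for `agree`, for `merge`, and leaves a remainder.
  have h3 : k * (200 * k + 500) = k * (20 * k + 50) + k * (80 * k + 110) + k * (100 * k + 340) := by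
    ring
  refine .of_wp rfl ?_
  simp only [Prog.join, Prog.cap, wp, Data.elim, List.getElem?_cons_zero,
    List.getElem?_cons_succ, Option.some.injEq, exists_eq_left', encodeEntry, encodeState]
  refine ⟨_, _, agree_returns _ _, fun R hR => ⟨_, _, rfl, rfl, fun h => ?_, fun h => ?_⟩⟩
  · have ha : agree f.1.2 e.1.2 = true := by simpa using h
    refine ⟨_, _, rfl, rfl, hc, _, _, rfl, rfl, fun h => ?_, fun h => ?_⟩
    · refine ⟨_, _, merge_returns _ _, fun S hS => ⟨_, _, rfl, rfl, hv, _, _, insert_returns_le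
        (e := ((3, merge f.1.2 e.1.2), e.2.1 + f.2.1, .join e.2.2 f.2.2)) (k := k)
        (by simpa using he) hA.le, fun U hU => ⟨?_, ?_⟩⟩⟩
      · simp only [stepJoin, joinEntry, ha, min_eq_left h, if_true]
      · unfold opCost
        omega
    · refine ⟨_, _, merge_returns _ _, fun S hS => ⟨_, _, rfl, rfl, hv, _, _, insert_returns_le
        (e := ((e.1.1 + f.1.1, merge f.1.2 e.1.2), e.2.1 + f.2.1, .join e.2.2 f.2.2)) (k := k)
        (by simpa using he) hA.le, fun U hU => ⟨?_, ?_⟩⟩⟩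
      · simp only [stepJoin, joinEntry, ha, min_eq_right (not_le.1 h).le, if_true]
      · unfold opCost
        omega
  · have ha : agree f.1.2 e.1.2 = false := by simpa using h
    refine ⟨?_, ?_⟩
    · simp [stepJoin, ha]
    · unfold opCost
      omega

/-- The loop of the program folds an operation over a table. The operation adds at most `r` entries
to a table. -/
theorem loop_returns {W S r B : ℕ} {op : Data} {f : Entry → List Entry → List Entry}
    {A acc : List Entry} (hr : ∀ e ∈ A, ∀ C, (f e C).length ≤ C.length + r)
    (hf : ∀ e ∈ A, ∀ C : List Entry, C.length < B →
      Returns bondProgram W 3 (.pair op (.pair (encodeEntry e) (encodeTable C)))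
        (encodeTable (f e C)) S)
    (hB : acc.length + r * A.length < B + r) :
    Returns bondProgram W 2 (.pair op (.pair (encodeTable A) (encodeTable acc)))
        (encodeTable (A.foldr f acc)) ((S + 20) * A.length + 10) ∧
      (A.foldr f acc).length ≤ acc.length + r * A.length := by
  induction A with
  | nil => exact ⟨.of_wp rfl (by simp [Prog.loop]), by simp⟩
  | cons e A ih =>
    simp only [List.length_cons, Nat.mul_add, Nat.mul_one] at hB ⊢
    obtain ⟨h1, h2⟩ := ih (fun e he => hr e (.tail _ he)) (fun e he => hf e (.tail _ he))
      (by omega)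
    constructor
    · refine .of_wp rfl ?_
      simp only [Prog.loop, wp, Data.elim, List.getElem?_cons_zero, encodeList,
        List.getElem?_cons_succ, Option.some.injEq, exists_eq_left', List.foldr_cons]
      -- The tail is processed first, as in `foldr`. Only the tables before an operation must be
      -- shorter than `B`; hence the additional `r` in `hB`.
      refine ⟨_, _, h1, fun T hT => ⟨_, _, hf e (.head _) _ (by omega), fun U hU => ⟨rfl, ?_⟩⟩⟩
      omega
    · have := hr e (.head _) (A.foldr f acc)
      rw [List.foldr_cons]
      omega

theorem length_stepVertex_le (v : ℕ) (e : Entry) (A : List Entry) :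
    (stepVertex v e A).length ≤ A.length + 2 := by
  have h1 := length_insertEntry_le (extendEntry v 1 e) A
  have h2 := length_insertEntry_le (extendEntry v 0 e) (insertEntry (extendEntry v 1 e) A)
  unfold stepVertex
  omega

theorem length_stepJoin_le (e f : Entry) (A : List Entry) :
    (stepJoin e f A).length ≤ A.length + 1 := by
  unfold stepJoin
  split_ifs
  · exact length_insertEntry_le _ _
  · omega

/-- Dispatch of the operations. -/
theorem step_returns {W S g tag : ℕ} {a x y : Data}
    (htag : (tag, g) ∈ [(1, 14), (2, 15), (3, 16), (4, 17), (5, 18)])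
    (h : Returns bondProgram W g (.pair a x) y S) :
    Returns bondProgram W 3 (.pair (.pair (.num tag) a) x) y (S + 40) := by
  refine .of_wp rfl ?_
  simp only [List.mem_cons, Prod.mk.injEq, List.not_mem_nil, or_false] at htag
  obtain ⟨rfl, rfl⟩ | ⟨rfl, rfl⟩ | ⟨rfl, rfl⟩ | ⟨rfl, rfl⟩ | ⟨rfl, rfl⟩ := htag <;>
  · simp [Prog.step]
    exact ⟨_, _, h, fun T hT => ⟨rfl, by omega⟩⟩

/-- Bound for the running time of the combination of an entry with a table of length less than `M`
at a join node. -/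
def rowCost (M k : ℕ) : ℕ := (opCost (M * M) k + 60) * M + 30

theorem joinRow_returns {W M k : ℕ} {e : Entry} {A acc : List Entry}
    (he : e.1.2.length ≤ k) (hA : ∀ f ∈ A, f.1.2.length ≤ k ∧ e.1.1 + f.1.1 ≤ W ∧ e.2.1 + f.2.1 ≤ W)
    (hM : A.length ≤ M) (hacc : acc.length + A.length ≤ M * M) :
    Returns bondProgram W 17 (.pair (encodeTable A) (.pair (encodeEntry e) (encodeTable acc)))
        (encodeTable (A.foldr (stepJoin e) acc)) (rowCost M k) := by
  refine .of_wp rfl ?_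
  simp only [Prog.joinRow, wp, Data.elim, List.getElem?_cons_zero,
    List.getElem?_cons_succ, Option.some.injEq, exists_eq_left']
  refine ⟨_, _, (loop_returns (op := .pair (.num 5) (encodeEntry e)) (r := 1) (B := M * M)
    (fun f _ => length_stepJoin_le e f) (fun f hf C hC => step_returns (by simp)
      (join_returns he (hA f hf).1 hC (hA f hf).2.1 (hA f hf).2.2)) (by omega)).1,
      fun T hT => ⟨rfl, ?_⟩⟩
  have : (opCost (M * M) k + 40 + 20) * A.length ≤ (opCost (M * M) k + 60) * M := by gcongr
  unfold rowCost
  omega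

end LargestBond

namespace LargestBond

open Relation

/-! ### Monochromatic components -/

namespace NTree

variable {V : Type*} [DecidableEq V]

/-- The vertices introduced in a tree. -/
def verts : NTree V → Finset V
  | leaf => ∅
  | introVertex v t => insert v t.verts
  | introEdge _ _ t => t.verts
  | forget _ t => t.verts
  | join s t => s.verts ∪ t.verts

/-- The edges introduced in a tree, as pairs. -/
def pairs : NTree V → List (V × V)
  | leaf => []
  | introVertex _ t => t.pairs
  | introEdge u v t => (u, v) :: t.pairs
  | forget _ t => t.pairs
  | join s t => s.pairs ++ t.pairs

/-- No vertex is introduced twice, except in different children of a join node with the vertex in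
its bag. -/
def Proper : NTree V → Prop
  | leaf => True
  | introVertex v t => v ∉ t.verts ∧ t.Proper
  | introEdge u v t => u ∈ t.bag ∧ v ∈ t.bag ∧ t.Proper
  | forget v t => v ∈ t.bag ∧ t.Proper
  | join s t => s.bag = t.bag ∧ s.verts ∩ t.verts ⊆ s.bag ∧ s.Proper ∧ t.Proper

theorem bag_subset_verts (t : NTree V) : t.bag ⊆ t.verts := by
  induction t with
  | leaf => exact subset_rfl
  | introVertex v t ih => exact Finset.insert_subset_insert v ih
  | introEdge u v t ih => exact ih
  | forget v t ih => exact (Finset.erase_subset _ _).trans ih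
  | join s t ihs _ => exact ihs.trans Finset.subset_union_left

theorem Proper.mem_verts {t : NTree V} (h : t.Proper) {u v : V} (huv : (u, v) ∈ t.pairs) :
    u ∈ t.verts ∧ v ∈ t.verts := by
  induction t with
  | leaf => cases huv
  | introVertex w t ih =>
    have := ih h.2 huv
    exact ⟨Finset.mem_insert_of_mem this.1, Finset.mem_insert_of_mem this.2⟩
  | introEdge x y t ih =>
    obtain heq | huv := List.mem_cons.1 huv
    · cases heq
      exact ⟨t.bag_subset_verts h.1, t.bag_subset_verts h.2.1⟩
    · exact ih h.2.2 huv
  | forget w t ih => exact ih h.2 huv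
  | join s t ihs iht =>
    obtain huv | huv := List.mem_append.1 huv
    · have := ihs h.2.2.1 huv
      exact ⟨Finset.mem_union_left _ this.1, Finset.mem_union_left _ this.2⟩
    · have := iht h.2.2.2 huv
      exact ⟨Finset.mem_union_right _ this.1, Finset.mem_union_right _ this.2⟩

/-- The monochromatic edges introduced in a tree. -/
def Mono (t : NTree V) (χ : V → Bool) (u v : V) : Prop := (u, v) ∈ t.pairs ∧ χ u = χ v

/-- `κ` maps every vertex to a representative of its component with respect to the monochromatic
edges. The representative is in the bag if the vertex is. -/
structure IsLabeling (t : NTree V) (χ : V → Bool) (κ : V → V) : Prop where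
  mono : ∀ u v, t.Mono χ u v → κ u = κ v
  conn : ∀ x, EqvGen (t.Mono χ) x (κ x)
  bag : ∀ x ∈ t.bag, κ x ∈ t.bag
  out : ∀ x ∉ t.verts, κ x = x
  verts : ∀ x ∈ t.verts, κ x ∈ t.verts

/-- The representatives of the closed components. -/
def closed (t : NTree V) (κ : V → V) : Finset V := t.verts.image κ \ t.bag

/-- The pairs of the bichromatic edges. -/
def cutPairs (t : NTree V) (χ : V → Bool) : List (V × V) :=
  t.pairs.filter fun p => χ p.1 != χ p.2

namespace IsLabeling

variable {t : NTree V} {χ : V → Bool} {κ : V → V}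

theorem eq_of_eqvGen (h : t.IsLabeling χ κ) {x y : V} (hxy : EqvGen (t.Mono χ) x y) :
    κ x = κ y := by
  induction hxy with
  | rel x y h' => exact h.mono x y h'
  | refl x => rfl
  | symm x y _ ih => exact ih.symm
  | trans x y z _ _ ih1 ih2 => exact ih1.trans ih2

theorem idem (h : t.IsLabeling χ κ) (x : V) : κ (κ x) = κ x := (h.eq_of_eqvGen (h.conn x)).symm

theorem congr (h : t.IsLabeling χ κ) (ht : t.Proper) {χ' : V → Bool}
    (hχ : ∀ v ∈ t.verts, χ v = χ' v) : t.IsLabeling χ' κ := by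
  have : t.Mono χ = t.Mono χ' := by
    ext u v
    refine and_congr_right fun huv => ?_
    rw [hχ u (ht.mem_verts huv).1, hχ v (ht.mem_verts huv).2]
  exact ⟨this ▸ h.mono, this ▸ h.conn, h.bag, h.out, h.verts⟩

end IsLabeling

theorem cutPairs_congr {t : NTree V} (ht : t.Proper) {χ χ' : V → Bool}
    (hχ : ∀ v ∈ t.verts, χ v = χ' v) : t.cutPairs χ = t.cutPairs χ' := by
  refine List.filter_congr fun p hp => ?_
  rw [hχ _ (ht.mem_verts hp).1, hχ _ (ht.mem_verts hp).2]

theorem isLabeling_leaf (χ : V → Bool) : (leaf : NTree V).IsLabeling χ id where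
  mono _ _ h := by cases h.1
  conn x := .refl x
  bag _ h := h
  out _ _ := rfl
  verts _ h := h

/-- By `out` the new vertex already represents itself, so `κ` needs no change. It is the only new
representative, it lies in the new bag, and no old vertex is mapped to it. -/
theorem IsLabeling.introVertex {t : NTree V} {χ : V → Bool} {κ : V → V} (h : t.IsLabeling χ κ)
    {v : V} (hv : v ∉ t.verts) :
    (introVertex v t).IsLabeling χ κ ∧ (NTree.introVertex v t).closed κ = t.closed κ := by
  have hκ := h.out v hv
  have hb : ∀ s ⊆ t.verts, v ∉ s := fun s hs hvs => hv (hs hvs)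
  refine ⟨⟨h.mono, h.conn, ?_, ?_, ?_⟩, ?_⟩
  · intro x hx
    obtain rfl | hx := Finset.mem_insert.1 hx
    · rw [hκ]
      exact Finset.mem_insert_self _ _
    · exact Finset.mem_insert_of_mem (h.bag x hx)
  · intro x hx
    exact h.out x fun hx' => hx (Finset.mem_insert_of_mem hx')
  · intro x hx
    obtain rfl | hx := Finset.mem_insert.1 hx
    · rw [hκ]
      exact Finset.mem_insert_self _ _
    · exact Finset.mem_insert_of_mem (h.verts x hx)
  · ext y
    simp only [closed, NTree.verts, NTree.bag, Finset.mem_sdiff, Finset.mem_image,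
      Finset.mem_insert]
    constructor
    · rintro ⟨⟨x, rfl | hx, rfl⟩, hy⟩
      · exact absurd (Or.inl hκ) hy
      · exact ⟨⟨x, hx, rfl⟩, fun h' => hy (.inr h')⟩
    · rintro ⟨⟨x, hx, rfl⟩, hy⟩
      refine ⟨⟨x, .inr hx, rfl⟩, ?_⟩
      rintro (h' | h')
      · exact hv (h' ▸ h.verts x hx)
      · exact hy h'

/-- The function that maps `a` to `b` and everything else to itself. -/
def relabel (a b x : V) : V := if x = a then b else x

/-- A monochromatic edge unites two components that meet the bag, by redirecting one representative
to the other. Both are in the bag, so closed components are unaffected. -/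
theorem IsLabeling.introEdge {t : NTree V} {χ : V → Bool} {κ : V → V} (h : t.IsLabeling χ κ)
    {u v : V} (hu : u ∈ t.bag) (hv : v ∈ t.bag) (huv : χ u = χ v) :
    (introEdge u v t).IsLabeling χ (relabel (κ u) (κ v) ∘ κ) ∧
      (NTree.introEdge u v t).closed (relabel (κ u) (κ v) ∘ κ) = t.closed κ := by
  have hm : ∀ x y, EqvGen (t.Mono χ) x y → EqvGen ((NTree.introEdge u v t).Mono χ) x y :=
    EqvGen.mono fun x y hxy => ⟨.tail _ hxy.1, hxy.2⟩
  have hκu := h.bag u hu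
  have hκv := h.bag v hv
  refine ⟨⟨?_, ?_, ?_, ?_, ?_⟩, ?_⟩
  · rintro x y ⟨hxy, hc⟩
    obtain heq | hxy := List.mem_cons.1 hxy
    · cases heq
      simp [relabel]
    · simp only [Function.comp_apply, h.mono x y ⟨hxy, hc⟩]
  · intro x
    simp only [Function.comp_apply, relabel]
    split_ifs with hx
    · refine .trans _ _ _ (hm _ _ (h.conn x)) (hx ▸ ?_)
      exact .trans _ _ _ (.symm _ _ (hm _ _ (h.conn u)))
        (.trans _ _ _ (.rel _ _ ⟨.head _, huv⟩) (hm _ _ (h.conn v)))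
    · exact hm _ _ (h.conn x)
  · intro x hx
    simp only [Function.comp_apply, relabel]
    split_ifs
    exacts [hκv, h.bag x hx]
  · intro x hx
    simp only [Function.comp_apply, h.out x hx, relabel]
    rw [if_neg]
    rintro rfl
    exact hx (t.bag_subset_verts hκu)
  · intro x hx
    simp only [Function.comp_apply, relabel]
    split_ifs
    exacts [t.bag_subset_verts hκv, h.verts x hx]
  · ext y
    simp only [closed, NTree.verts, NTree.bag, Finset.mem_sdiff, Finset.mem_image,
      Function.comp_apply, relabel]
    constructor
    · rintro ⟨⟨x, hx, rfl⟩, hy⟩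
      split_ifs at hy ⊢ with hxu
      · exact absurd hκv hy
      · exact ⟨⟨x, hx, rfl⟩, hy⟩
    · rintro ⟨⟨x, hx, rfl⟩, hy⟩
      exact ⟨⟨x, hx, if_neg fun h' : κ x = κ u => hy (h' ▸ hκu)⟩, hy⟩

theorem IsLabeling.introEdge_of_ne {t : NTree V} {χ : V → Bool} {κ : V → V}
    (h : t.IsLabeling χ κ) {u v : V} (huv : χ u ≠ χ v) : (NTree.introEdge u v t).IsLabeling χ κ where
  mono x y hxy := by
    obtain ⟨hxy, hc⟩ := hxy
    obtain heq | hxy := List.mem_cons.1 hxy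
    · cases heq
      exact absurd hc huv
    · exact h.mono x y ⟨hxy, hc⟩
  conn x := EqvGen.mono (fun x y hxy => ⟨.tail _ hxy.1, hxy.2⟩) _ _ (h.conn x)
  bag := h.bag
  out := h.out
  verts := h.verts

/-- The component of `v` still meets the bag in `u` and stays open. Its representative may be `v`
itself, so it is moved to `u`. -/
theorem IsLabeling.forget {t : NTree V} {χ : V → Bool} {κ : V → V} (h : t.IsLabeling χ κ)
    {u v : V} (hv : v ∈ t.bag) (hu : u ∈ t.bag) (huv : u ≠ v) (hκ : κ u = κ v) :
    (forget v t).IsLabeling χ (relabel (κ v) u ∘ κ) ∧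
      (NTree.forget v t).closed (relabel (κ v) u ∘ κ) = t.closed κ := by
  have hne : ∀ x, κ x ≠ κ v → κ x ≠ v := fun x hx hxv => hx (by rw [← hxv, h.idem])
  refine ⟨⟨?_, ?_, ?_, ?_, ?_⟩, ?_⟩
  · intro x y hxy
    simp only [Function.comp_apply, h.mono x y hxy]
  · intro x
    simp only [Function.comp_apply, relabel]
    split_ifs with hx
    · exact .trans _ _ _ (h.conn x) (.symm _ _ (hx ▸ hκ ▸ h.conn u))
    · exact h.conn x
  · intro x hx
    simp only [Function.comp_apply, relabel]
    split_ifs with hxv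
    · exact Finset.mem_erase.2 ⟨huv, hu⟩
    · exact Finset.mem_erase.2 ⟨hne x hxv, h.bag x (Finset.mem_of_mem_erase hx)⟩
  · intro x hx
    simp only [Function.comp_apply, h.out x hx, relabel]
    rw [if_neg]
    rintro rfl
    exact hx (t.bag_subset_verts (h.bag v hv))
  · intro x hx
    simp only [Function.comp_apply, relabel]
    split_ifs
    exacts [t.bag_subset_verts hu, h.verts x hx]
  · ext y
    simp only [closed, NTree.verts, NTree.bag, Finset.mem_sdiff, Finset.mem_image,
      Function.comp_apply, relabel, Finset.mem_erase, not_and]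
    constructor
    · rintro ⟨⟨x, hx, rfl⟩, hy⟩
      split_ifs at hy ⊢ with hxv
      · exact absurd hu (hy huv)
      · exact ⟨⟨x, hx, rfl⟩, hy (hne x hxv)⟩
    · rintro ⟨⟨x, hx, rfl⟩, hy⟩
      exact ⟨⟨x, hx, if_neg fun h' : κ x = κ v => hy (h' ▸ h.bag v hv)⟩, fun _ => hy⟩

/-- If `v` is the only bag vertex of its component, it is its own representative, and forgetting it
closes precisely this component. -/
theorem IsLabeling.forget_closed {t : NTree V} {χ : V → Bool} {κ : V → V} (h : t.IsLabeling χ κ)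
    {v : V} (hv : v ∈ t.bag) (hκ : ∀ u ∈ t.bag, u ≠ v → κ u ≠ κ v) :
    (NTree.forget v t).IsLabeling χ κ ∧
      ((NTree.forget v t).closed κ).card = (t.closed κ).card + 1 := by
  have hvv : κ v = v := by
    by_contra hne
    exact hκ _ (h.bag v hv) hne (h.idem v)
  refine ⟨⟨h.mono, h.conn, ?_, h.out, h.verts⟩, ?_⟩
  · intro x hx
    obtain ⟨hxv, hx⟩ := Finset.mem_erase.1 hx
    exact Finset.mem_erase.2 ⟨fun h' => hκ x hx hxv (h'.trans hvv.symm), h.bag x hx⟩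
  · have : (NTree.forget v t).closed κ = insert v (t.closed κ) := by
      ext y
      simp only [closed, NTree.verts, NTree.bag, Finset.mem_sdiff, Finset.mem_image,
        Finset.mem_erase, Finset.mem_insert, not_and]
      constructor
      · rintro ⟨hy, hyb⟩
        by_cases hyv : y = v
        · exact .inl hyv
        · exact .inr ⟨hy, hyb hyv⟩
      · rintro (rfl | ⟨hy, hyb⟩)
        · exact ⟨⟨y, t.bag_subset_verts hv, hvv⟩, fun h' => absurd rfl h'⟩
        · exact ⟨hy, fun _ => hyb⟩
    rw [this, Finset.card_insert_of_notMem]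
    simp [closed, hv]

/-- Both sides share only bag vertices, so components interact only through the bag. There `g`
identifies the `κ`-representatives that `μ` forces together, and `hgc` says that it identifies
nothing else. Closed components of the two sides stay closed and distinct. -/
theorem IsLabeling.join {s t : NTree V} {χ : V → Bool} {κ μ g : V → V} (hs : s.IsLabeling χ κ)
    (ht : t.IsLabeling χ μ) (hst : (join s t).Proper) (hg : ∀ x ∉ s.bag, g x = x)
    (hgb : ∀ x ∈ s.bag, g x ∈ s.bag) (hgm : ∀ v ∈ s.bag, g (κ v) = g (κ (μ v)))
    (hgc : ∀ x, EqvGen ((join s t).Mono χ) x (g x)) :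
    (NTree.join s t).IsLabeling χ (g ∘ κ ∘ μ) ∧ (∀ x ∈ s.bag, (g ∘ κ ∘ μ) x = g (κ x)) ∧
      ((NTree.join s t).closed (g ∘ κ ∘ μ)).card = (s.closed κ).card + (t.closed μ).card := by
  obtain ⟨hb, hi, hps, hpt⟩ := hst
  have hi' : ∀ x ∈ s.verts, x ∈ t.verts → x ∈ s.bag := fun x h1 h2 =>
    hi (Finset.mem_inter.2 ⟨h1, h2⟩)
  have hgv : ∀ x ∈ s.verts, g x ∈ s.verts := fun x hx => by
    by_cases hxb : x ∈ s.bag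
    · exact s.bag_subset_verts (hgb x hxb)
    · rwa [hg x hxb]
  have hgb' : ∀ x, g x ∈ s.bag → x ∈ s.bag := fun x hx => by
    by_contra hxb
    rw [hg x hxb] at hx
    exact hxb hx
  have hsv : ∀ x ∈ s.verts, g (κ (μ x)) = g (κ x) := fun x hx => by
    by_cases hxt : x ∈ t.verts
    · exact (hgm x (hi' x hx hxt)).symm
    · rw [ht.out x hxt]
  -- A representative closed in `t` is not a vertex of `s`, since common vertices are in the bag; so
  -- `κ` and `g` fix it.
  have htv : ∀ x ∈ t.verts, μ x ∉ t.bag → g (κ (μ x)) = μ x := fun x hx hxb => by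
    have h1 : μ x ∉ s.verts := fun h' => hxb (hb ▸ hi' _ h' (ht.verts x hx))
    rw [hs.out _ h1, hg]
    exact fun h' => h1 (s.bag_subset_verts h')
  have hms : ∀ x y, EqvGen (s.Mono χ) x y → EqvGen ((NTree.join s t).Mono χ) x y :=
    EqvGen.mono fun x y hxy => ⟨List.mem_append_left _ hxy.1, hxy.2⟩
  have hmt : ∀ x y, EqvGen (t.Mono χ) x y → EqvGen ((NTree.join s t).Mono χ) x y :=
    EqvGen.mono fun x y hxy => ⟨List.mem_append_right _ hxy.1, hxy.2⟩
  refine ⟨⟨?_, ?_, ?_, ?_, ?_⟩, ?_, ?_⟩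
  · rintro x y ⟨hxy, hc⟩
    simp only [Function.comp_apply]
    obtain hxy | hxy := List.mem_append.1 hxy
    · rw [hsv x (hps.mem_verts hxy).1, hsv y (hps.mem_verts hxy).2, hs.mono x y ⟨hxy, hc⟩]
    · rw [ht.mono x y ⟨hxy, hc⟩]
  · intro x
    exact .trans _ _ _ (hmt _ _ (ht.conn x)) (.trans _ _ _ (hms _ _ (hs.conn _)) (hgc _))
  · intro x hx
    exact hgb _ (hs.bag _ (hb ▸ ht.bag x (hb ▸ hx)))
  · intro x hx
    simp only [NTree.verts, Finset.mem_union, not_or] at hx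
    simp only [Function.comp_apply, ht.out x hx.2, hs.out x hx.1]
    exact hg x fun h' => hx.1 (s.bag_subset_verts h')
  · intro x hx
    simp only [NTree.verts, Finset.mem_union, Function.comp_apply] at hx ⊢
    by_cases hxs : x ∈ s.verts
    · rw [hsv x hxs]
      exact .inl (hgv _ (hs.verts x hxs))
    · have hxt := hx.resolve_left hxs
      by_cases hxb : μ x ∈ t.bag
      · exact .inl (hgv _ (hs.verts _ (s.bag_subset_verts (hb ▸ hxb))))
      · rw [htv x hxt hxb]
        exact .inr (ht.verts x hxt)
  · exact fun x hx => hsv x (s.bag_subset_verts hx)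
  -- A common element would be a vertex of both sides, hence in the bag, hence not closed.
  · have hd : Disjoint (s.closed κ) (t.closed μ) := by
      rw [Finset.disjoint_left]
      intro y hys hyt
      simp only [closed, Finset.mem_sdiff, Finset.mem_image] at hys hyt
      obtain ⟨⟨x, hx, rfl⟩, hxb⟩ := hys
      obtain ⟨⟨z, hz, hzx⟩, -⟩ := hyt
      exact hxb (hi' _ (hs.verts x hx) (hzx ▸ ht.verts z hz))
    rw [← Finset.card_union_of_disjoint hd]
    congr 1
    ext y
    simp only [closed, NTree.verts, NTree.bag, Finset.mem_sdiff, Finset.mem_image,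
      Finset.mem_union, Function.comp_apply]
    constructor
    · rintro ⟨⟨x, hx, rfl⟩, hy⟩
      by_cases hxs : x ∈ s.verts
      · rw [hsv x hxs] at hy ⊢
        have : κ x ∉ s.bag := fun h' => hy (hgb _ h')
        rw [hg _ this]
        exact .inl ⟨⟨x, hxs, rfl⟩, this⟩
      · have hxt := hx.resolve_left hxs
        by_cases hxb : μ x ∈ t.bag
        · exact absurd (hgb _ (hs.bag _ (hb ▸ hxb))) hy
        · rw [htv x hxt hxb]
          exact .inr ⟨⟨x, hxt, rfl⟩, hxb⟩
    · rintro (⟨⟨x, hx, rfl⟩, hy⟩ | ⟨⟨x, hx, rfl⟩, hy⟩)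
      · refine ⟨⟨x, .inl hx, ?_⟩, hy⟩
        rw [hsv x hx, hg _ hy]
      · exact ⟨⟨x, .inr hx, htv x hx hy⟩, hb ▸ hy⟩

end NTree

end LargestBond

namespace LargestBond

open Relation NTree

/-! ### States represent partial solutions -/

variable {n : ℕ}

/-- The records of a bag. -/
def records (X : List (Fin n)) (χ : Fin n → Bool) (κ : Fin n → Fin n) : List Rec :=
  X.map fun v : Fin n => ((v : ℕ), (χ v).toNat, (κ v : ℕ))

theorem lookup_records {X : List (Fin n)} (χ : Fin n → Bool) (κ : Fin n → Fin n) {v : Fin n}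
    (hv : v ∈ X) : lookup v (records X χ κ) = ((χ v).toNat, (κ v : ℕ)) := by
  induction X with
  | nil => cases hv
  | cons x X ih =>
    simp only [records, List.map_cons, lookup, Fin.val_inj]
    split_ifs with h
    · rw [h]
    · exact ih ((List.mem_cons.1 hv).resolve_left (Ne.symm h))

theorem rename_records (X : List (Fin n)) (χ : Fin n → Bool) (κ : Fin n → Fin n) (a b : Fin n) :
    rename a b (records X χ κ) = records X χ (relabel a b ∘ κ) := by
  simp only [rename, records, List.map_map]
  refine List.map_congr_left fun v _ => ?_
  simp only [Function.comp_apply, relabel, Fin.val_inj]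
  split_ifs <;> rfl

theorem eraseVertex_records (X : List (Fin n)) (χ : Fin n → Bool) (κ : Fin n → Fin n)
    (v : Fin n) :
    eraseVertex v (records X χ κ) = records (X.filter (· ≠ v)) χ κ := by
  induction X with
  | nil => rfl
  | cons x X ih =>
    simp only [records, List.map_cons, eraseVertex, Fin.val_inj] at ih ⊢
    by_cases h : x = v <;> simp [h, ih]

theorem findLabel_records (X : List (Fin n)) (χ : Fin n → Bool) (κ : Fin n → Fin n)
    (l : Fin n) :
    findLabel l (records X χ κ) = (X.find? (κ · = l)).map fun u : Fin n => (u : ℕ) := by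
  induction X with
  | nil => rfl
  | cons x X ih =>
    simp only [records, List.map_cons, findLabel, Fin.val_inj] at ih ⊢
    by_cases h : κ x = l <;> simp [h, ih]

theorem unite_records {X : List (Fin n)} (χ : Fin n → Bool) (κ : Fin n → Fin n) {u v : Fin n}
    (hu : u ∈ X) (hv : v ∈ X) :
    unite u v (records X χ κ) = records X χ (relabel (κ u) (κ v) ∘ κ) := by
  rw [unite, lookup_records χ κ hu, lookup_records χ κ hv, rename_records]

theorem agree_records {X Y : List (Fin n)} (hY : ∀ v ∈ Y, v ∈ X) (χ χ' : Fin n → Bool)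
    (κ κ' : Fin n → Fin n) :
    agree (records Y χ' κ') (records X χ κ) = true ↔ ∀ v ∈ Y, χ v = χ' v := by
  induction Y with
  | nil => simp [records, agree]
  | cons y Y ih =>
    have ih := ih fun v hv => hY v (.tail _ hv)
    simp only [records, List.map_cons, agree] at ih ⊢
    rw [← records, lookup_records χ κ (hY y (.head _))]
    have : (χ y).toNat = (χ' y).toNat ↔ χ y = χ' y := by
      cases χ y <;> cases χ' y <;> simp
    by_cases h : χ y = χ' y
    · simpa [h, records] using ih
    · simp [h, this]

/-- Each record of `Y` unites the classes of a vertex and its `μ`-representative, and `g` is the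
composite of these relabellings. `R` stands for connectedness at the join node; it is kept abstract
so that `κ` can vary in the induction. -/
theorem merge_records {X Y : List (Fin n)} {B : Finset (Fin n)} (hX : ∀ v ∈ B, v ∈ X)
    (hY : ∀ v ∈ Y, v ∈ B) (χ : Fin n → Bool) {κ μ : Fin n → Fin n} (hκ : ∀ v ∈ B, κ v ∈ B)
    (hμ : ∀ v ∈ B, μ v ∈ B) {R : Fin n → Fin n → Prop} (hR : Equivalence R)
    (hRκ : ∀ v, R v (κ v)) (hRμ : ∀ v, R v (μ v)) :
    ∃ g : Fin n → Fin n, merge (records Y χ μ) (records X χ κ) = records X χ (g ∘ κ) ∧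
      (∀ x ∉ B, g x = x) ∧ (∀ x ∈ B, g x ∈ B) ∧ (∀ v ∈ Y, g (κ v) = g (κ (μ v))) ∧
      ∀ x, R x (g x) := by
  induction Y generalizing κ with
  | nil => exact ⟨id, rfl, fun _ _ => rfl, fun _ h => h, by simp, fun x => hR.refl x⟩
  | cons y Y ih =>
    have hy := hY y (.head _)
    have hr : ∀ x, R x (relabel (κ y) (κ (μ y)) x) := fun x => by
      unfold relabel
      split_ifs with h
      · rw [h]
        exact hR.trans (hR.symm (hRκ y)) (hR.trans (hRμ y) (hRκ _))
      · exact hR.refl x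
    obtain ⟨g, h1, h2, h3, h4, h5⟩ := ih (κ := relabel (κ y) (κ (μ y)) ∘ κ)
      (fun v hv => hY v (.tail _ hv)) (fun v hv => by
        simp only [Function.comp_apply, relabel]
        split_ifs
        exacts [hκ _ (hμ y hy), hκ v hv])
      (fun v => hR.trans (hRκ v) (hr _))
    refine ⟨g ∘ relabel (κ y) (κ (μ y)), ?_, ?_, ?_, ?_, fun x => hR.trans (hr x) (h5 _)⟩
    · rw [Function.comp_assoc, ← h1, ← unite_records χ κ (hX y hy) (hX _ (hμ y hy))]
      rfl
    · intro x hx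
      rw [Function.comp_apply, relabel, if_neg, h2 x hx]
      rintro rfl
      exact hx (hκ y hy)
    · intro x hx
      refine h3 _ ?_
      unfold relabel
      split_ifs
      exacts [hκ _ (hμ y hy), hx]
    · intro v hv
      obtain rfl | hv := List.mem_cons.1 hv
      · simp [relabel]
      · exact h4 v hv

/-- The state `s` represents the colouring `χ` of the vertices of the tree `t`. -/
def Represents (t : NTree (Fin n)) (χ : Fin n → Bool) (s : State) : Prop :=
  ∃ X κ, X.Nodup ∧ X.toFinset = t.bag ∧ t.IsLabeling χ κ ∧ s.2 = records X χ κ ∧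
    s.1 = min 3 (t.closed κ).card

theorem Represents.congr {t : NTree (Fin n)} (ht : t.Proper) {χ χ' : Fin n → Bool} {s : State}
    (h : Represents t χ s) (hχ : ∀ v ∈ t.verts, χ v = χ' v) : Represents t χ' s := by
  obtain ⟨X, κ, h1, h2, h3, h4, h5⟩ := h
  refine ⟨X, κ, h1, h2, h3.congr ht hχ, h4.trans (List.map_congr_left fun v hv => ?_), h5⟩
  rw [hχ v (t.bag_subset_verts (h2 ▸ List.mem_toFinset.2 hv))]

theorem Represents.length_eq {t : NTree (Fin n)} {χ : Fin n → Bool} {s : State}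
    (h : Represents t χ s) : s.2.length = t.bag.card := by
  obtain ⟨X, κ, h1, h2, -, h4, -⟩ := h
  rw [h4, ← h2, List.toFinset_card_of_nodup h1, records, List.length_map]

theorem Represents.count_le {t : NTree (Fin n)} {χ : Fin n → Bool} {s : State}
    (h : Represents t χ s) : s.1 ≤ 3 := by
  obtain ⟨X, κ, -, -, -, -, h5⟩ := h
  exact h5.trans_le (min_le_left _ _)

theorem represents_leaf (χ : Fin n → Bool) : Represents leaf χ (0, []) :=
  ⟨[], id, List.nodup_nil, rfl, isLabeling_leaf χ, rfl, rfl⟩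

theorem Represents.introVertex {t : NTree (Fin n)} {χ : Fin n → Bool} {e : Entry}
    (h : Represents t χ e.1) {v : Fin n} (hv : v ∉ t.verts) :
    Represents (introVertex v t) χ (extendEntry v (χ v).toNat e).1 := by
  obtain ⟨X, κ, h1, h2, h3, h4, h5⟩ := h
  have hvX : v ∉ X := fun h' => hv (t.bag_subset_verts (h2 ▸ List.mem_toFinset.2 h'))
  refine ⟨v :: X, κ, List.nodup_cons.2 ⟨hvX, h1⟩, ?_, (h3.introVertex hv).1, ?_, ?_⟩
  · rw [List.toFinset_cons, h2, NTree.bag]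
  · simp only [extendEntry, h4, records, List.map_cons, h3.out v hv]
  · rw [(h3.introVertex hv).2]
    exact h5

theorem Represents.introEdge {t : NTree (Fin n)} {χ : Fin n → Bool} {e : Entry}
    (h : Represents t χ e.1) {u v : Fin n} (hu : u ∈ t.bag) (hv : v ∈ t.bag) :
    Represents (introEdge u v t) χ (edgeEntry u v e).1 ∧
      (edgeEntry u v e).2 = if χ u = χ v then e.2 else (e.2.1 + 1, .edge u v e.2.2) := by
  obtain ⟨X, κ, h1, h2, h3, h4, h5⟩ := h
  have hu' : u ∈ X := List.mem_toFinset.1 (h2 ▸ hu)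
  have hv' : v ∈ X := List.mem_toFinset.1 (h2 ▸ hv)
  have : (χ u).toNat = (χ v).toNat ↔ χ u = χ v := by
    cases χ u <;> cases χ v <;> simp
  unfold edgeEntry
  rw [h4, lookup_records χ κ hu', lookup_records χ κ hv']
  simp only [this]
  split_ifs with hc
  · refine ⟨⟨X, _, h1, h2, (h3.introEdge hu hv hc).1, unite_records χ κ hu' hv', ?_⟩, rfl⟩
    rw [(h3.introEdge hu hv hc).2]
    exact h5
  · exact ⟨⟨X, κ, h1, h2, h3.introEdge_of_ne hc, h4, h5⟩, rfl⟩

theorem Represents.forget {t : NTree (Fin n)} {χ : Fin n → Bool} {s : State}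
    (h : Represents t χ s) {v : Fin n} (hv : v ∈ t.bag) :
    Represents (forget v t) χ (forgetState v s) := by
  obtain ⟨X, κ, h1, h2, h3, h4, h5⟩ := h
  have hX : ∀ {x}, x ∈ X ↔ x ∈ t.bag := fun {x} => by rw [← h2, List.mem_toFinset]
  have hb : (X.filter (· ≠ v)).toFinset = (NTree.forget v t).bag := by
    ext x
    simp [NTree.bag, hX, and_comm]
  unfold forgetState
  rw [h4, lookup_records χ κ (hX.2 hv), eraseVertex_records, findLabel_records]
  cases hf : (X.filter (· ≠ v)).find? (κ · = κ v) with
  | some u =>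
    have hκ : κ u = κ v := by simpa using List.find?_some hf
    have hu := List.mem_filter.1 (List.mem_of_find?_eq_some hf)
    have := h3.forget hv (hX.1 hu.1) (by simpa using hu.2) hκ
    refine ⟨_, _, h1.filter _, hb, this.1, rename_records _ χ κ _ u, ?_⟩
    rw [this.2]
    exact h5
  | none =>
    have := h3.forget_closed hv fun u hu huv => by
      simpa using List.find?_eq_none.1 hf u (List.mem_filter.2 ⟨hX.2 hu, by simpa using huv⟩)
    refine ⟨_, _, h1.filter _, hb, this.1, rfl, ?_⟩
    rw [this.2]
    simp only [h5, Option.map_none]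
    -- Capping commutes with the increment: `min 3 (min 3 c + 1) = min 3 (c + 1)`.
    omega

theorem Represents.agree_iff {s t : NTree (Fin n)} (hst : (join s t).Proper)
    {χ χ' : Fin n → Bool} {a b : State} (ha : Represents s χ a) (hb : Represents t χ' b) :
    agree b.2 a.2 = true ↔ ∀ v ∈ s.bag, χ v = χ' v := by
  obtain ⟨X, κ, -, h2, -, h4, -⟩ := ha
  obtain ⟨Y, μ, -, k2, -, k4, -⟩ := hb
  have hYX : ∀ v, v ∈ Y ↔ v ∈ X := fun v => by
    rw [← List.mem_toFinset, k2, ← hst.1, ← h2, List.mem_toFinset]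
  rw [h4, k4, agree_records fun v hv => (hYX v).1 hv, ← h2]
  simp [hYX]

theorem Represents.join {s t : NTree (Fin n)} (hst : (join s t).Proper)
    {χ : Fin n → Bool} {e f : Entry} (he : Represents s χ e.1) (hf : Represents t χ f.1) :
    Represents (join s t) χ (joinEntry e f).1 := by
  obtain ⟨X, κ, h1, h2, h3, h4, h5⟩ := he
  obtain ⟨Y, μ, k1, k2, k3, k4, k5⟩ := hf
  have hY : ∀ {v}, v ∈ Y ↔ v ∈ s.bag := fun {v} => by rw [hst.1, ← k2, List.mem_toFinset]
  have hX : ∀ {v}, v ∈ X ↔ v ∈ s.bag := fun {v} => by rw [← h2, List.mem_toFinset]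
  obtain ⟨g, g1, g2, g3, g4, g5⟩ := merge_records (X := X) (Y := Y) (B := s.bag)
    (fun v => hX.2) (fun v => hY.1) χ h3.bag (fun v hv => hst.1 ▸ k3.bag v (hst.1 ▸ hv))
    (EqvGen.is_equivalence ((NTree.join s t).Mono χ))
    (fun v => EqvGen.mono (fun x y hxy => ⟨List.mem_append_left _ hxy.1, hxy.2⟩) _ _ (h3.conn v))
    (fun v => EqvGen.mono (fun x y hxy => ⟨List.mem_append_right _ hxy.1, hxy.2⟩) _ _ (k3.conn v))
  obtain ⟨j1, j2, j3⟩ := h3.join k3 hst g2 g3 (fun v hv => g4 v (hY.2 hv)) g5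
  refine ⟨X, _, h1, h2, j1, ?_, ?_⟩
  · simp only [joinEntry, h4, k4, g1]
    refine List.map_congr_left fun v hv => ?_
    rw [j2 v (hX.1 hv), Function.comp_apply]
  · simp only [joinEntry, h5, k5, j3]
    omega

end LargestBond

namespace LargestBond

open NTree

/-! ### Tables -/

theorem mem_insertEntry {e x : Entry} {A : List Entry} (h : x ∈ insertEntry e A) :
    x = e ∨ x ∈ A := by
  induction A with
  | nil => simpa [insertEntry] using h
  | cons a A ih =>
    unfold insertEntry at h
    split_ifs at h
    · exact (List.mem_cons.1 h).imp_right (.tail _)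
    · exact .inr h
    · obtain rfl | h := List.mem_cons.1 h
      · exact .inr (.head _)
      · exact (ih h).imp_right (.tail _)

/-- The table `A` has an entry with the same state as `x` that is at least as large. -/
def Better (x : Entry) (A : List Entry) : Prop := ∃ y ∈ A, y.1 = x.1 ∧ x.2.1 ≤ y.2.1

theorem Better.of_mem {x : Entry} {A : List Entry} (h : x ∈ A) : Better x A := ⟨x, h, rfl, le_rfl⟩

theorem Better.cons {x : Entry} {A : List Entry} (h : Better x A) (a : Entry) :
    Better x (a :: A) := by
  obtain ⟨y, hy, h⟩ := h
  exact ⟨y, .tail _ hy, h⟩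

theorem better_insertEntry_self (e : Entry) (A : List Entry) : Better e (insertEntry e A) := by
  induction A with
  | nil => exact .of_mem (.head _)
  | cons a A ih =>
    unfold insertEntry
    split_ifs with h1 h2
    · exact .of_mem (.head _)
    · exact ⟨a, .head _, h1.symm, (not_le.1 h2).le⟩
    · exact ih.cons a

/-- An entry is displaced only by one with the same state and at least as many edges. -/
theorem Better.insertEntry {x : Entry} {A : List Entry} (h : Better x A) (e : Entry) :
    Better x (insertEntry e A) := by
  induction A with
  | nil =>
    obtain ⟨y, hy, -⟩ := h
    cases hy
  | cons a A ih =>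
    obtain ⟨y, hy, h⟩ := h
    unfold LargestBond.insertEntry
    obtain rfl | hy := List.mem_cons.1 hy
    · split_ifs with h1 h2
      · exact ⟨e, .head _, h1.trans h.1, h.2.trans h2⟩
      · exact ⟨y, .head _, h⟩
      · exact ⟨y, .head _, h⟩
    · split_ifs with h1 h2
      · exact ⟨y, .tail _ hy, h⟩
      · exact ⟨y, .tail _ hy, h⟩
      · exact (ih ⟨y, hy, h⟩).cons a

theorem nodup_insertEntry {A : List Entry} (h : (A.map Prod.fst).Nodup) (e : Entry) :
    ((insertEntry e A).map Prod.fst).Nodup := by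
  induction A with
  | nil => simp [insertEntry]
  | cons a A ih =>
    unfold insertEntry
    rw [List.map_cons, List.nodup_cons] at h
    split_ifs with h1 h2
    · rw [List.map_cons, h1]
      exact List.nodup_cons.2 h
    · exact List.nodup_cons.2 h
    · refine List.nodup_cons.2 ⟨fun hm => ?_, ih h.2⟩
      obtain ⟨x, hx, hxa⟩ := List.mem_map.1 hm
      obtain rfl | hx := mem_insertEntry hx
      · exact h1 hxa
      · exact h.1 (hxa ▸ List.mem_map_of_mem hx)

/-! ### Invariants of folds over tables -/

section Foldr

variable {f : Entry → List Entry → List Entry} {A acc : List Entry}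

/-- `R e x` stands for "the operation can create `x` from `e`", so every new entry can be traced to
its origin. -/
theorem mem_foldr {R : Entry → Entry → Prop} (hf : ∀ e C x, x ∈ f e C → x ∈ C ∨ R e x) {x : Entry}
    (hx : x ∈ A.foldr f acc) : x ∈ acc ∨ ∃ e ∈ A, R e x := by
  induction A with
  | nil => exact .inl hx
  | cons a A ih =>
    obtain h | h := hf _ _ _ hx
    · refine (ih h).imp_right ?_
      rintro ⟨e, he, h⟩
      exact ⟨e, .tail _ he, h⟩
    · exact .inr ⟨a, .head _, h⟩

theorem Better.foldr {x : Entry} (h : Better x acc) (hf : ∀ e C, Better x C → Better x (f e C)) :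
    Better x (A.foldr f acc) := by
  induction A with
  | nil => exact h
  | cons a A ih => exact hf _ _ ih

theorem better_foldr_of_mem {x e : Entry} (he : e ∈ A) (hx : ∀ C, Better x (f e C))
    (hf : ∀ e C, Better x C → Better x (f e C)) : Better x (A.foldr f acc) := by
  induction A with
  | nil => cases he
  | cons a A ih =>
    obtain rfl | he := List.mem_cons.1 he
    · exact hx _
    · exact hf _ _ (ih he)

theorem nodup_foldr (h : (acc.map Prod.fst).Nodup)
    (hf : ∀ e C, (C.map Prod.fst).Nodup → ((f e C).map Prod.fst).Nodup) :
    ((A.foldr f acc).map Prod.fst).Nodup := by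
  induction A with
  | nil => exact h
  | cons a A ih => exact hf _ _ ih

end Foldr

theorem nodup_stepJoin (e f : Entry) (C : List Entry) (h : (C.map Prod.fst).Nodup) :
    ((stepJoin e f C).map Prod.fst).Nodup := by
  unfold stepJoin
  split_ifs
  exacts [nodup_insertEntry h _, h]

theorem Better.stepJoin {x : Entry} {C : List Entry} (h : Better x C) (e f : Entry) :
    Better x (stepJoin e f C) := by
  unfold LargestBond.stepJoin
  split_ifs
  exacts [h.insertEntry _, h]

variable {n : ℕ}

theorem nodup_table (t : NTree (Fin n)) : ((table t).map Prod.fst).Nodup := by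
  cases t with
  | leaf => simp [table]
  | introVertex v t =>
    exact nodup_foldr List.nodup_nil fun e C h => nodup_insertEntry (nodup_insertEntry h _) _
  | introEdge u v t => exact nodup_foldr List.nodup_nil fun e C h => nodup_insertEntry h _
  | forget v t => exact nodup_foldr List.nodup_nil fun e C h => nodup_insertEntry h _
  | join s t =>
    exact nodup_foldr List.nodup_nil fun e C h => nodup_foldr h fun f C h => nodup_stepJoin e f C h

/-- The entry `e` describes the partial solution for the tree `t` given by the colouring `χ`. -/
structure Describes (t : NTree (Fin n)) (χ : Fin n → Bool) (e : Entry) : Prop where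
  state : Represents t χ e.1
  value : e.2.1 = (t.cutPairs χ).length
  toList : e.2.2.toList = (t.cutPairs χ).map fun p => ((p.1 : ℕ), (p.2 : ℕ))
  size : e.2.2.size ≤ t.numNodes

theorem Describes.congr {t : NTree (Fin n)} (ht : t.Proper) {χ χ' : Fin n → Bool} {e : Entry}
    (h : Describes t χ e) (hχ : ∀ v ∈ t.verts, χ v = χ' v) : Describes t χ' e where
  state := h.state.congr ht hχ
  value := cutPairs_congr ht hχ ▸ h.value
  toList := cutPairs_congr ht hχ ▸ h.toList
  size := h.size

theorem cutPairs_introEdge (t : NTree (Fin n)) (χ : Fin n → Bool) (u v : Fin n) :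
    (introEdge u v t).cutPairs χ =
      if χ u = χ v then t.cutPairs χ else (u, v) :: t.cutPairs χ := by
  simp only [cutPairs, pairs, List.filter_cons, bne_iff_ne, ne_eq, ite_not]

theorem cutPairs_join (s t : NTree (Fin n)) (χ : Fin n → Bool) :
    (join s t).cutPairs χ = s.cutPairs χ ++ t.cutPairs χ := by
  simp only [cutPairs, pairs, List.filter_append]

/-- Every entry of the table of a tree describes a partial solution. -/
theorem exists_describes {t : NTree (Fin n)} (ht : t.Proper) {x : Entry} (hx : x ∈ table t) :
    ∃ χ, Describes t χ x := by
  induction t generalizing x with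
  | leaf =>
    obtain rfl := List.mem_singleton.1 hx
    exact ⟨fun _ => false, represents_leaf _, rfl, rfl, le_rfl⟩
  | introVertex v t ih =>
    obtain hx | ⟨e, he, hR⟩ := mem_foldr (R := fun e x => ∃ b : Bool, x = extendEntry v b.toNat e)
      (fun e C x hx => by
        obtain rfl | hx := mem_insertEntry hx
        · exact .inr ⟨false, rfl⟩
        · obtain rfl | hx := mem_insertEntry hx
          exacts [.inr ⟨true, rfl⟩, .inl hx]) hx
    · cases hx
    · obtain ⟨b, rfl⟩ := hR
      obtain ⟨χ, h⟩ := ih ht.2 he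
      -- `v` does not occur below, so its colour in `χ` can be overwritten by the one chosen for the
      -- entry.
      replace h := h.congr ht.2 (χ' := Function.update χ v b) fun w hw => by
        rw [Function.update_of_ne]
        rintro rfl
        exact ht.1 hw
      have hb := h.state.introVertex ht.1
      rw [Function.update_self] at hb
      exact ⟨_, hb, h.value, h.toList, h.size.trans (Nat.le_succ _)⟩
  | introEdge u v t ih =>
    obtain hx | ⟨e, he, rfl⟩ := mem_foldr (R := fun e x => x = edgeEntry u v e)
      (fun e C x hx => (mem_insertEntry hx).symm) hx
    · cases hx
    · obtain ⟨χ, h⟩ := ih ht.2.2 he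
      obtain ⟨h1, h2⟩ := h.state.introEdge ht.1 ht.2.1
      refine ⟨χ, h1, ?_, ?_, ?_⟩
      · rw [h2, cutPairs_introEdge]
        split_ifs <;> simp [h.value]
      · rw [h2, cutPairs_introEdge]
        split_ifs <;> simp [h.toList, Sol.toList]
      · have := h.size
        rw [h2]
        split_ifs <;> simp only [Sol.size, numNodes] <;> omega
  | forget v t ih =>
    obtain hx | ⟨e, he, rfl⟩ := mem_foldr (R := fun e x => x = (forgetState v e.1, e.2))
      (fun e C x hx => (mem_insertEntry hx).symm) hx
    · cases hx
    · obtain ⟨χ, h⟩ := ih ht.2 he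
      exact ⟨χ, h.state.forget ht.1, h.value, h.toList, h.size.trans (Nat.le_succ _)⟩
  | join s t ihs iht =>
    obtain hx | ⟨e, he, f, hf, ha, rfl⟩ := mem_foldr
      (R := fun e x => ∃ f ∈ table t, agree f.1.2 e.1.2 = true ∧ x = joinEntry e f)
      (fun e C x hx => mem_foldr (R := fun f x => agree f.1.2 e.1.2 = true ∧ x = joinEntry e f)
        (fun f C x hx => by
          unfold stepJoin at hx
          split_ifs at hx with ha
          · exact (mem_insertEntry hx).symm.imp_right fun h => ⟨ha, h⟩
          · exact .inl hx) hx) hx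
    · cases hx
    · obtain ⟨χ, h⟩ := ihs ht.2.2.1 he
      obtain ⟨χ', h'⟩ := iht ht.2.2.2 hf
      have hc := (Represents.agree_iff ht h.state h'.state).1 ha
      -- The two colourings are glued: they agree on the bag, which contains all common vertices.
      replace h := h.congr ht.2.2.1 (χ' := fun v => if v ∈ s.verts then χ v else χ' v)
        fun v hv => (if_pos hv).symm
      replace h' := h'.congr ht.2.2.2 (χ' := fun v => if v ∈ s.verts then χ v else χ' v)
        fun v hv => by
          split_ifs with hs
          · exact (hc v (ht.2.1 (Finset.mem_inter.2 ⟨hs, hv⟩))).symm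
          · rfl
      refine ⟨_, h.state.join ht h'.state, ?_, ?_, ?_⟩
      · simp only [joinEntry, cutPairs_join, List.length_append, h.value, h'.value]
      · simp only [joinEntry, cutPairs_join, List.map_append, Sol.toList, h.toList, h'.toList]
      · have h1 := h.size
        have h2 := h'.size
        simp only [joinEntry, Sol.size, numNodes]
        omega

/-- For every colouring, the table contains an entry that is at least as good. -/
theorem exists_mem_table {t : NTree (Fin n)} (ht : t.Proper) (χ : Fin n → Bool) :
    ∃ e ∈ table t, Represents t χ e.1 ∧ (t.cutPairs χ).length ≤ e.2.1 := by
  -- Optimal substructure: `Represents` depends on the state alone, so an entry with the same state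
  -- and more edges can replace `x`, even if it arose from another colouring.
  have key : ∀ {t : NTree (Fin n)} {x : Entry}, Better x (table t) → Represents t χ x.1 →
      (t.cutPairs χ).length ≤ x.2.1 →
      ∃ e ∈ table t, Represents t χ e.1 ∧ (t.cutPairs χ).length ≤ e.2.1 := by
    rintro t x ⟨y, hy, h1, h2⟩ h3 h4
    exact ⟨y, hy, h1 ▸ h3, h4.trans h2⟩
  induction t with
  | leaf => exact ⟨_, .head _, represents_leaf χ, le_rfl⟩
  | introVertex v t ih =>
    obtain ⟨e, he, h1, h2⟩ := ih ht.2
    refine key (better_foldr_of_mem he (fun C => ?_)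
      fun e C hC => (hC.insertEntry _).insertEntry _) (h1.introVertex ht.1) h2
    cases χ v with
    | false => exact better_insertEntry_self _ _
    | true => exact (better_insertEntry_self _ _).insertEntry _
  | introEdge u v t ih =>
    obtain ⟨e, he, h1, h2⟩ := ih ht.2.2
    obtain ⟨h3, h4⟩ := h1.introEdge ht.1 ht.2.1
    refine key (better_foldr_of_mem he (fun C => better_insertEntry_self _ _)
      fun e C hC => hC.insertEntry _) h3 ?_
    rw [h4, cutPairs_introEdge]
    split_ifs
    · exact h2
    · exact Nat.succ_le_succ h2
  | forget v t ih =>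
    obtain ⟨e, he, h1, h2⟩ := ih ht.2
    exact key (better_foldr_of_mem he (fun C => better_insertEntry_self _ _)
      fun e C hC => hC.insertEntry _) (h1.forget ht.1) h2
  | join s t ihs iht =>
    obtain ⟨e, he, h1, h2⟩ := ihs ht.2.2.1
    obtain ⟨f, hf, h3, h4⟩ := iht ht.2.2.2
    refine key (better_foldr_of_mem he (fun C => better_foldr_of_mem hf (fun C => ?_)
      fun f C hC => hC.stepJoin e f) fun e C hC => hC.foldr fun f C hC => hC.stepJoin e f)
      (h1.join ht h3) ?_
    · rw [stepJoin, if_pos ((Represents.agree_iff ht h1 h3).2 fun _ _ => rfl)]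
      exact better_insertEntry_self _ _
    · rw [cutPairs_join, List.length_append]
      exact Nat.add_le_add h2 h4

/-- Bound for the length of the tables of trees with root bags of size at most `k`. -/
def tableBound (k : ℕ) : ℕ := 4 * (2 * (k + 1) * (k + 1)) ^ k

/-- States in a table are distinct. Each consists of a count below 4 and one record per position,
with vertex and label in the bag and one of two colours. Leaving the vertex at each position free
allows for all orders of the records. -/
theorem length_table_le {t : NTree (Fin n)} (ht : t.Proper) {k : ℕ} (hk : t.bag.card ≤ k) :
    (table t).length ≤ tableBound k := by
  classical
  let B := t.bag
  let X : Finset (ℕ × ℕ × ℕ) :=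
    (B.image Fin.val) ×ˢ (Finset.range 2 ×ˢ (B.image Fin.val))
  let Y : Finset (ℕ × (Fin B.card → ℕ × ℕ × ℕ)) :=
    Finset.range 4 ×ˢ Fintype.piFinset fun _ => X
  have hY : Y.card ≤ tableBound k := by
    simp only [Y, X, Finset.card_product, Fintype.card_piFinset, Finset.card_range,
      Finset.prod_const, Finset.card_univ, Fintype.card_fin,
      Finset.card_image_of_injective _ Fin.val_injective, tableBound]
    have h1 : B.card * (2 * B.card) ≤ 2 * (k + 1) * (k + 1) := by
      have : B.card ≤ k + 1 := hk.trans (Nat.le_succ k)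
      calc B.card * (2 * B.card) ≤ (k + 1) * (2 * (k + 1)) := by gcongr
        _ = 2 * (k + 1) * (k + 1) := by ring
    refine Nat.mul_le_mul_left 4 ?_
    calc (B.card * (2 * B.card)) ^ B.card ≤ (2 * (k + 1) * (k + 1)) ^ B.card := by gcongr
      _ ≤ (2 * (k + 1) * (k + 1)) ^ k := Nat.pow_le_pow_right (by positivity) hk
  refine le_trans ?_ hY
  rw [← List.length_map (f := Prod.fst), ← List.toFinset_card_of_nodup (nodup_table t)]
  -- The default record is never used, since every record list has length `B.card`.
  refine Finset.card_le_card_of_injOn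
    (fun s => (s.1, fun i : Fin B.card => s.2.getD i (0, 0, 0))) ?_ ?_
  · intro s hs
    obtain ⟨e, he, rfl⟩ := List.mem_map.1 (List.mem_toFinset.1 hs)
    obtain ⟨χ, h⟩ := exists_describes ht he
    have hl := h.state.length_eq
    obtain ⟨L, κ, -, h2, h3, h4, h5⟩ := h.state
    simp only [Y, Finset.coe_product, Set.mem_prod, Finset.mem_coe, Finset.mem_range,
      Fintype.mem_piFinset]
    refine ⟨by omega, fun i => ?_⟩
    have hi : (i : ℕ) < e.1.2.length := hl.symm ▸ i.2
    have := List.getElem_mem hi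
    rw [List.getD_eq_getElem _ _ hi]
    simp only [h4, records, List.mem_map] at this ⊢
    obtain ⟨v, hv, hvi⟩ := this
    rw [← hvi]
    have hv : v ∈ t.bag := h2 ▸ List.mem_toFinset.2 hv
    simp only [X, Finset.mem_product, Finset.mem_image, Finset.mem_range]
    refine ⟨⟨v, hv, rfl⟩, ?_, ⟨_, h3.bag v hv, rfl⟩⟩
    cases χ v <;> simp
  · intro s hs s' hs' hss
    obtain ⟨e, he, rfl⟩ := List.mem_map.1 (List.mem_toFinset.1 hs)
    obtain ⟨e', he', rfl⟩ := List.mem_map.1 (List.mem_toFinset.1 hs')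
    obtain ⟨χ, h⟩ := exists_describes ht he
    obtain ⟨χ', h'⟩ := exists_describes ht he'
    have hl := h.state.length_eq
    have hl' := h'.state.length_eq
    simp only [Prod.mk.injEq] at hss
    refine Prod.ext hss.1 (List.ext_getElem (hl.trans hl'.symm) fun i h1 h2 => ?_)
    have := congrFun hss.2 ⟨i, hl ▸ h1⟩
    simpa only [List.getD_eq_getElem _ _ h1, List.getD_eq_getElem _ _ h2] using this

end LargestBond

namespace LargestBond

open NTree

/-! ### The running time of the program -/

attribute [local simp ↓] wp
attribute [local simp] Data.elim encodeList encodeRec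

variable {n : ℕ}

/-- Bound for the number of steps spent at a node of a tree. -/
def nodeCost (M k : ℕ) : ℕ := (rowCost M k + 60) * M + 60

/-- `nodeCost` is designed for the nested loops of a join node; the single loop of a unary node fits
into it too. -/
theorem opCost_loop_le {M k l : ℕ} (hl : l ≤ M) (hM : 1 ≤ M) :
    (opCost (M * M) k + 40 + 20) * l + 40 ≤ nodeCost M k := by
  have h1 : (opCost (M * M) k + 40 + 20) * l ≤ (opCost (M * M) k + 60) * M := by gcongr
  have h2 : rowCost M k ≤ rowCost M k * M := Nat.le_mul_of_pos_right _ hM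
  simp only [nodeCost, rowCost, Nat.add_mul] at h1 h2 ⊢
  omega

theorem four_le_tableBound (k : ℕ) : 4 ≤ tableBound k :=
  Nat.le_mul_of_pos_right _ (by positivity)

theorem length_cutPairs_le (t : NTree (Fin n)) (χ : Fin n → Bool) :
    (t.cutPairs χ).length ≤ t.pairs.length := List.length_filter_le _ _

/-- The entries of a table are small. -/
theorem entry_bounds {t : NTree (Fin n)} (ht : t.Proper) {e : Entry} (he : e ∈ table t) :
    e.1.2.length = t.bag.card ∧ e.1.1 ≤ 3 ∧ e.2.1 ≤ t.pairs.length := by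
  obtain ⟨χ, h⟩ := exists_describes ht he
  exact ⟨h.state.length_eq, h.state.count_le, h.value ▸ length_cutPairs_le t χ⟩

theorem bag_card_le (t : NTree (Fin n)) : t.bag.card ≤ t.maxBagCard := by
  cases t with
  | leaf => exact le_rfl
  | introVertex v t => exact le_max_left _ _
  | introEdge u v t => exact le_max_left _ _
  | forget v t => exact le_max_left _ _
  | join s t => exact le_max_left _ _

/-- A unary node of a tree is processed by a loop over the table of its child. -/
theorem unary_returns {W k r tag g : ℕ} {a : Data} {t : NTree (Fin n)} (ht : t.Proper)
    (hk : t.bag.card ≤ k) {f : Entry → List Entry → List Entry}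
    (htag : (tag, g) ∈ [(1, 14), (2, 15), (3, 16), (4, 17), (5, 18)]) (h4 : tag ≠ 4) (hr : r ≤ 2)
    (hf : ∀ e C, (f e C).length ≤ C.length + r)
    (hop : ∀ e ∈ table t, ∀ C : List Entry, C.length < tableBound k * tableBound k →
      Returns bondProgram W g (.pair a (.pair (encodeEntry e) (encodeTable C)))
        (encodeTable (f e C)) (opCost (tableBound k * tableBound k) k))
    {x : Data} {c : ℕ} (hx : Returns bondProgram W 1 x (encodeTable (table t)) c) :
    Returns bondProgram W 1 (.pair (.num tag) (.pair a x)) (encodeTable ((table t).foldr f []))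
      (c + nodeCost (tableBound k) k) := by
  have hM := length_table_le ht hk
  have h4M := four_le_tableBound k
  have hB : ([] : List Entry).length + r * (table t).length < tableBound k * tableBound k + r := by
    have h1 : r * (table t).length ≤ 2 * tableBound k := Nat.mul_le_mul hr hM
    have h2 : 4 * tableBound k ≤ tableBound k * tableBound k := Nat.mul_le_mul_right _ h4M
    simp only [List.length_nil]
    omega
  have hl := (loop_returns (op := .pair (.num tag) a) (fun e _ C => hf e C)
    (fun e he C hC => step_returns htag (hop e he C hC)) hB).1
  have hc := opCost_loop_le (k := k) hM (by omega)
  refine .of_wp rfl ?_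
  simp only [Prog.solve, wp, Data.elim, List.getElem?_cons_zero,
    List.getElem?_cons_succ, Option.some.injEq, exists_eq_left']
  refine ⟨_, _, rfl, rfl, fun h => absurd h h4, fun _ => ⟨_, _, hx, fun T hT => ?_⟩⟩
  exact ⟨_, _, hl, fun U hU => ⟨rfl, by omega⟩⟩

/-- The program computes the table of a tree. -/
theorem solve_returns {W k : ℕ} {t : NTree (Fin n)} (ht : t.Proper) (hk : t.maxBagCard ≤ k)
    (hW : t.pairs.length ≤ W) (h6 : 6 ≤ W) :
    Returns bondProgram W 1 t.encode (encodeTable (table t))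
      (nodeCost (tableBound k) k * t.numNodes) := by
  induction t with
  | leaf =>
    refine Returns.mono (B := 20) (.of_wp rfl ?_) ?_
    · simp [Prog.solve, NTree.encode, table, encodeEntry, encodeState, Sol.encode]
    · simp only [numNodes, nodeCost]
      omega
  | introVertex v t ih =>
    have hk' := (le_max_right _ _).trans hk
    rw [numNodes, Nat.mul_add_one]
    refine unary_returns (g := 14) (r := 2) ht.2 ((bag_card_le t).trans hk') (by simp) (by simp)
      le_rfl (length_stepVertex_le v) (fun e he C hC => introVertex_returns v ?_ hC)
      (ih ht.2 hk' hW)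
    rw [(entry_bounds ht.2 he).1, ← Finset.card_insert_of_notMem (a := v) fun h =>
      ht.1 (t.bag_subset_verts h)]
    exact (le_max_left _ _).trans hk
  | introEdge u v t ih =>
    have hk' := (le_max_right _ _).trans hk
    simp only [pairs, List.length_cons] at hW
    rw [numNodes, Nat.mul_add_one]
    refine unary_returns (g := 15) (r := 1) ht.2.2 ((bag_card_le t).trans hk') (by simp) (by simp)
      one_le_two (fun e C => length_insertEntry_le _ C) (fun e he C hC => ?_)
      (ih ht.2.2 hk' (by omega))
    obtain ⟨h1, h2, h3⟩ := entry_bounds ht.2.2 he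
    exact introEdge_returns u v (h1.trans_le ((bag_card_le t).trans hk')) hC (by omega)
  | forget v t ih =>
    have hk' := (le_max_right _ _).trans hk
    rw [numNodes, Nat.mul_add_one]
    refine unary_returns (g := 16) (r := 1) ht.2 ((bag_card_le t).trans hk') (by simp) (by simp)
      one_le_two (fun e C => length_insertEntry_le _ C) (fun e he C hC => ?_)
      (ih ht.2 hk' hW)
    obtain ⟨h1, h2, h3⟩ := entry_bounds ht.2 he
    exact forget_returns v (h1.trans_le ((bag_card_le t).trans hk')) hC (by omega)
  | join s t ihs iht =>
    have hks := ((le_max_left _ _).trans (le_max_right _ _)).trans hk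
    have hkt := ((le_max_right _ _).trans (le_max_right _ _)).trans hk
    simp only [pairs, List.length_append] at hW
    have hs := ihs ht.2.2.1 hks (by omega)
    have ht' := iht ht.2.2.2 hkt (by omega)
    have hMs := length_table_le ht.2.2.1 ((bag_card_le s).trans hks)
    have hMt := length_table_le ht.2.2.2 ((bag_card_le t).trans hkt)
    have hMM : (table t).length * (table s).length ≤ tableBound k * tableBound k :=
      Nat.mul_le_mul hMt hMs
    have h4M := four_le_tableBound k
    have hMM' : 4 * tableBound k ≤ tableBound k * tableBound k := Nat.mul_le_mul_right _ h4M
    have hl := (loop_returns (W := W) (op := .pair (.num 4) (encodeTable (table t)))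
      -- With this `B` a whole row fits: an accumulator shorter than `B` grows to at most
      -- `tableBound k * tableBound k` entries.
      (r := (table t).length) (B := tableBound k * tableBound k + 1 - (table t).length)
      (S := rowCost (tableBound k) k + 40)
      (A := table s) (acc := []) (f := fun e acc => (table t).foldr (stepJoin e) acc)
      (fun e he C => ?_) (fun e he C hC => step_returns (g := 17) (by simp)
        (joinRow_returns ?_ (fun f hf => ?_) hMt ?_)) ?_).1
    · refine .of_wp rfl ?_
      simp only [Prog.solve, NTree.encode, wp, Data.elim, List.getElem?_cons_zero,
        List.getElem?_cons_succ, Option.some.injEq, exists_eq_left']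
      refine ⟨_, _, rfl, rfl, fun _ => ⟨_, _, ht', fun T hT => ⟨_, _, hs, fun S hS =>
        ⟨_, _, hl, fun U hU => ⟨rfl, ?_⟩⟩⟩⟩, fun h => absurd rfl h⟩
      have hc : (rowCost (tableBound k) k + 40 + 20) * (table s).length ≤
        (rowCost (tableBound k) k + 60) * tableBound k := Nat.mul_le_mul_left _ hMs
      rw [numNodes, Nat.mul_add_one, Nat.mul_add]
      unfold nodeCost at *
      omega
    · have : ∀ (A : List Entry), (A.foldr (stepJoin e) C).length ≤ C.length + A.length := by
        intro A
        induction A with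
        | nil => exact le_rfl
        | cons a A ih =>
          have := length_stepJoin_le e a (A.foldr (stepJoin e) C)
          simp only [List.foldr_cons, List.length_cons]
          omega
      exact this _
    · exact (entry_bounds ht.2.2.1 he).1.trans_le ((bag_card_le s).trans hks)
    · obtain ⟨h1, h2, h3⟩ := entry_bounds ht.2.2.1 he
      obtain ⟨h1', h2', h3'⟩ := entry_bounds ht.2.2.2 hf
      exact ⟨h1'.trans_le ((bag_card_le t).trans hkt), by omega, by omega⟩
    · omega
    · simp only [List.length_nil]
      omega

/-- The program outputs the solution of the first entry with two closed components. -/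
theorem bondProgram_computes {W k : ℕ} {t : NTree (Fin n)} (ht : t.Proper) (hk : t.maxBagCard ≤ k)
    (hW : t.pairs.length ≤ W) (h6 : 6 ≤ W) (hp : (pick (table t)).size ≤ t.numNodes) :
    ∃ T, bondProgram.Computes W t.encode (encodeList encodePair (pick (table t)).toList) T ∧
      T ≤ 2 * nodeCost (tableBound k) k * t.numNodes := by
  have hM := length_table_le ht ((bag_card_le t).trans hk)
  have hs := solve_returns ht hk hW h6
  have hpos : 1 ≤ t.numNodes := by cases t <;> simp [numNodes]
  have hN : 60 * tableBound k + 60 ≤ nodeCost (tableBound k) k := by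
    unfold nodeCost
    rw [Nat.add_mul]
    omega
  have hle : nodeCost (tableBound k) k * t.numNodes + 30 * t.numNodes + 60 * tableBound k + 30 ≤
      2 * nodeCost (tableBound k) k * t.numNodes := by
    obtain ⟨N, hN⟩ := Nat.exists_eq_add_of_le hN
    have : 1 * (N + 60 * tableBound k + 30) ≤ t.numNodes * (N + 60 * tableBound k + 30) := by
      gcongr
    rw [hN]
    linarith
  -- Ten steps are held back for the initial call; `hle` leaves room for them.
  have hr : Returns bondProgram W 0 t.encode (encodeList encodePair (pick (table t)).toList)
      (2 * nodeCost (tableBound k) k * t.numNodes - 10) := by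
    refine .of_wp rfl ?_
    simp only [Prog.main, wp, List.getElem?_cons_zero, Option.some.injEq, exists_eq_left']
    refine ⟨_, _, hs, fun T hT => ⟨_, _, pick_returns _, fun U hU =>
      ⟨_, _, flatten_returns _ [], fun S hS => ⟨by rw [List.append_nil], ?_⟩⟩⟩⟩
    omega
  obtain ⟨body, T, hf, he, hT⟩ := hr
  refine ⟨_, .call (.var rfl) hf he, ?_⟩
  omega

end LargestBond

namespace LargestBond

open NTree

/-! ### Nice tree decompositions introduce every vertex properly -/

namespace NTree

variable {V : Type*}

theorem subtreeAt_append (t : NTree V) (p q : List Bool) :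
    t.subtreeAt (p ++ q) = (t.subtreeAt p).bind fun s => s.subtreeAt q := by
  induction p generalizing t with
  | nil => rfl
  | cons b p ih =>
    simp only [List.cons_append, subtreeAt]
    cases t.child b with
    | none => rfl
    | some s => exact ih s

theorem subtreeAt_snoc {t s : NTree V} {p : List Bool} (h : t.subtreeAt p = some s) (b : Bool) :
    t.subtreeAt (p ++ [b]) = s.child b := by
  rw [subtreeAt_append, h, Option.bind_some]
  change (s.child b).bind some = _
  simp

variable [DecidableEq V]

/-- The vertex `v` is in the bag of the node with address `p`. -/
def InBag (t : NTree V) (v : V) (p : List Bool) : Prop := ∃ s, t.subtreeAt p = some s ∧ v ∈ s.bag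

theorem inBag_iff (t : NTree V) (v : V) (p : t.Node) : v ∈ t.nodeBag p ↔ t.InBag v p.1 := by
  constructor
  · exact fun h => ⟨_, (Option.some_get p.2).symm, h⟩
  · rintro ⟨s, hs, hv⟩
    have : (t.subtreeAt p.1).get p.2 = s := by simp [hs]
    rwa [nodeBag, this]

/-- Links the recursive notion of vertex to the bags at addresses, in which tree decompositions are
phrased. -/
theorem mem_verts_iff {t : NTree V} {v : V} : v ∈ t.verts ↔ ∃ p, t.InBag v p := by
  have hcons : ∀ {t s : NTree V} {b : Bool}, t.child b = some s → ∀ p,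
      t.InBag v (b :: p) ↔ s.InBag v p := by
    intro t s b h p
    simp only [InBag, subtreeAt, h, Option.bind_some]
  have hnone : ∀ {t : NTree V} {b : Bool}, t.child b = none → ∀ p, ¬ t.InBag v (b :: p) := by
    rintro t b h p ⟨s, hs, -⟩
    simp [subtreeAt, h] at hs
  have hnil : ∀ t : NTree V, t.InBag v [] ↔ v ∈ t.bag := fun t => by simp [InBag, subtreeAt]
  have hex : ∀ t : NTree V, (∃ p, t.InBag v p) ↔
      v ∈ t.bag ∨ (∃ p, t.InBag v (false :: p)) ∨ ∃ p, t.InBag v (true :: p) := by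
    intro t
    constructor
    · rintro ⟨_ | ⟨_ | _, p⟩, h⟩
      exacts [.inl ((hnil t).1 h), .inr (.inl ⟨p, h⟩), .inr (.inr ⟨p, h⟩)]
    · rintro (h | ⟨p, h⟩ | ⟨p, h⟩)
      exacts [⟨_, (hnil t).2 h⟩, ⟨_, h⟩, ⟨_, h⟩]
  have hb := fun t : NTree V => @bag_subset_verts V _ t v
  induction t with
  | leaf =>
    rw [hex]
    simp [verts, bag, hnone (t := (leaf : NTree V)) (b := false) rfl,
      hnone (t := (leaf : NTree V)) (b := true) rfl]
  | introVertex w t ih =>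
    rw [hex]
    simp only [hcons (t := introVertex w t) (b := false) rfl, ← ih,
      hnone (t := introVertex w t) (b := true) rfl, verts, bag, Finset.mem_insert, exists_false,
      or_false, or_assoc, or_iff_right_of_imp (hb t)]
  | introEdge x y t ih =>
    rw [hex]
    simp only [hcons (t := introEdge x y t) (b := false) rfl, ← ih,
      hnone (t := introEdge x y t) (b := true) rfl, verts, bag, exists_false,
      or_false, or_iff_right_of_imp (hb t)]
  | forget w t ih =>
    rw [hex]
    simp only [hcons (t := forget w t) (b := false) rfl, ← ih,
      hnone (t := forget w t) (b := true) rfl, verts, bag, exists_false, or_false]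
    exact (or_iff_right_of_imp fun h => hb t (Finset.mem_of_mem_erase h)).symm
  | join s t ihs iht =>
    rw [hex]
    simp only [hcons (t := join s t) (b := false) rfl, hcons (t := join s t) (b := true) rfl,
      ← ihs, ← iht, verts, bag, Finset.mem_union]
    exact (or_iff_right_of_imp fun h => .inl (hb s h)).symm

/-- If a vertex is in the bag of a node below the address `a` and in the bag of a node that is not
below `a`, then it is in the bag at `a`. -/
theorem inBag_of_preconnected {t : NTree V} {v : V}
    (hc : (t.nodeGraph.induce {p : t.Node | v ∈ t.nodeBag p}).Preconnected)
    {a p q : List Bool} (hp : t.InBag v p) (hq : t.InBag v q) (hap : a <+: p) (haq : ¬ a <+: q) :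
    t.InBag v a := by
  have hnode : ∀ {p}, t.InBag v p → (t.subtreeAt p).isSome := by
    rintro p ⟨s, hs, -⟩
    simp [hs]
  have hmem : ∀ {p} (h : t.InBag v p),
      (⟨p, hnode h⟩ : t.Node) ∈ {p : t.Node | v ∈ t.nodeBag p} :=
    fun h => (t.inBag_iff v _).2 h
  obtain ⟨w⟩ := hc ⟨_, hmem hp⟩ ⟨_, hmem hq⟩
  -- The walk from `p` to `q` must leave the subtree at `a`, and the only edge leaving it starts at
  -- `a` itself.
  obtain ⟨d, -, h1, h2⟩ := w.exists_boundary_dart {x | a <+: x.1.1} hap haq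
  have hadj : t.nodeGraph.Adj d.fst.1 d.snd.1 := d.adj
  have h3 := (t.inBag_iff v _).1 d.fst.2
  simp only [Set.mem_ofPred_eq] at h1 h2
  simp only [nodeGraph, SimpleGraph.fromRel_adj] at hadj
  obtain ⟨-, ⟨b, hb⟩ | ⟨b, hb⟩⟩ := hadj
  · exact absurd (hb ▸ h1.trans (List.prefix_append _ _)) h2
  · rw [hb, List.prefix_concat_iff] at h1
    obtain h1 | h1 := h1
    · rw [h1, ← hb]
      exact h3
    · exact absurd h1 h2

theorem mem_bag_of_preconnected {t : NTree V} {v : V}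
    (hc : (t.nodeGraph.induce {p : t.Node | v ∈ t.nodeBag p}).Preconnected)
    {a q : List Bool} {r : NTree V} (hr : t.subtreeAt a = some r) (hv : v ∈ r.verts)
    (hq : t.InBag v q) (haq : ¬ a <+: q) : v ∈ r.bag := by
  obtain ⟨p, r', hp, hvp⟩ := mem_verts_iff.1 hv
  obtain ⟨r'', h1, h2⟩ := inBag_of_preconnected hc (a := a) (p := a ++ p)
    ⟨r', by rw [subtreeAt_append, hr, Option.bind_some, hp], hvp⟩ hq
    (List.prefix_append _ _) haq
  rw [hr, Option.some_inj] at h1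
  exact h1 ▸ h2

/-- A vertex introduced at a node is in the bag there, so an occurrence below would put it into the
child's bag, against `WellFormed`. At a join node, an occurrence in the right subtree lies outside
the left one, so a common vertex is in the left bag. -/
theorem proper_of_preconnected {t : NTree V}
    (hc : ∀ v, (t.nodeGraph.induce {p : t.Node | v ∈ t.nodeBag p}).Preconnected)
    {a : List Bool} {s : NTree V} (ha : t.subtreeAt a = some s) (hs : s.WellFormed) :
    s.Proper := by
  induction s generalizing a with
  | leaf => trivial
  | introVertex v s ih =>
    have hch := subtreeAt_snoc ha false
    refine ⟨fun hv => hs.1 (mem_bag_of_preconnected (hc v) hch hv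
      ⟨_, ha, Finset.mem_insert_self _ _⟩ fun h => by simpa using h.length_le), ih hch hs.2⟩
  | introEdge u v s ih => exact ⟨hs.1, hs.2.1, ih (subtreeAt_snoc ha false) hs.2.2⟩
  | forget v s ih => exact ⟨hs.1, ih (subtreeAt_snoc ha false) hs.2⟩
  | join s r ihs ihr =>
    have hs' := subtreeAt_snoc ha false
    have hr := subtreeAt_snoc ha true
    refine ⟨hs.1, fun v hv => ?_, ihs hs' hs.2.1, ihr hr hs.2.2⟩
    obtain ⟨hvs, hvr⟩ := Finset.mem_inter.1 hv
    obtain ⟨p, r', hp, hvp⟩ := mem_verts_iff.1 hvr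
    refine mem_bag_of_preconnected (hc v) hs' hvs (q := a ++ [true] ++ p)
      ⟨r', by rw [subtreeAt_append, hr]; exact hp, hvp⟩ fun h => ?_
    have := List.prefix_of_prefix_length_le h (List.prefix_append _ _) (by simp)
    simp at this

end NTree

theorem IsNiceTreeDecomposition.proper {V : Type*} [DecidableEq V] {G : SimpleGraph V}
    {t : NTree V} (h : IsNiceTreeDecomposition G t) : t.Proper :=
  proper_of_preconnected h.connected (a := []) rfl h.wellFormed

theorem IsNiceTreeDecomposition.mem_verts {V : Type*} [DecidableEq V] {G : SimpleGraph V}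
    {t : NTree V} (h : IsNiceTreeDecomposition G t) (v : V) : v ∈ t.verts := by
  obtain ⟨p, hp⟩ := h.vertex_mem v
  exact mem_verts_iff.2 ⟨p.1, (t.inBag_iff v p).1 hp⟩

theorem NTree.edges_eq_map {V : Type*} (t : NTree V) :
    t.edges = t.pairs.map fun p => s(p.1, p.2) := by
  induction t with
  | leaf => rfl
  | introVertex v t ih => exact ih
  | introEdge u v t ih => simp only [edges, pairs, List.map_cons, ih]
  | forget v t ih => exact ih
  | join s t ihs iht => simp only [edges, pairs, List.map_append, ihs, iht]

end LargestBond

namespace LargestBond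

/-! ### Bonds are cuts with two components -/

section Cuts

variable {V : Type*} (G : SimpleGraph V)

/-- The bichromatic edges of a colouring. -/
def cut (χ : V → Bool) : Set (Sym2 V) := {e | ∃ u v, G.Adj u v ∧ χ u ≠ χ v ∧ e = s(u, v)}

variable {G}

theorem mk_mem_cut {χ : V → Bool} {u v : V} : s(u, v) ∈ cut G χ ↔ G.Adj u v ∧ χ u ≠ χ v := by
  constructor
  · rintro ⟨x, y, h1, h2, h3⟩
    obtain ⟨rfl, rfl⟩ | ⟨rfl, rfl⟩ := Sym2.eq_iff.1 h3
    exacts [⟨h1, h2⟩, ⟨h1.symm, h2.symm⟩]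
  · exact fun h => ⟨u, v, h.1, h.2, rfl⟩

theorem cut_subset (χ : V → Bool) : cut G χ ⊆ G.edgeSet := by
  rintro _ ⟨u, v, h, -, rfl⟩
  exact h

theorem deleteEdges_cut_adj {χ : V → Bool} {u v : V} :
    (G.deleteEdges (cut G χ)).Adj u v ↔ G.Adj u v ∧ χ u = χ v := by
  rw [SimpleGraph.deleteEdges_adj, mk_mem_cut]
  tauto

theorem eq_of_reachable {α : Type*} {H : SimpleGraph V} {f : V → α}
    (hf : ∀ u v, H.Adj u v → f u = f v)
    {u v : V} (h : H.Reachable u v) : f u = f v := by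
  obtain ⟨w⟩ := h
  induction w with
  | nil => rfl
  | cons h _ ih => exact (hf _ _ h).trans ih

variable [Fintype V] [DecidableEq V]

/-- The map `κ` sends every vertex to a representative of its component in the graph without the
bichromatic edges of `χ`. -/
structure IsComponentMap (G : SimpleGraph V) (χ : V → Bool) (κ : V → V) : Prop where
  adj : ∀ u v, (G.deleteEdges (cut G χ)).Adj u v → κ u = κ v
  reachable : ∀ u, (G.deleteEdges (cut G χ)).Reachable u (κ u)

/-- A smaller disconnecting set would leave out some cut edge. Colours are constant on components,
so this edge joins the two components and the graph stays connected. -/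
theorem isBond_cut {χ : V → Bool} {κ : V → V} (hκ : IsComponentMap G χ κ)
    (h2 : (Finset.univ.image κ).card = 2) : IsBond G (cut G χ) := by
  refine ⟨⟨cut_subset χ, fun hc => ?_⟩, ?_⟩
  · obtain ⟨a, b, hab, hi⟩ := Finset.card_eq_two.1 h2
    obtain ⟨x, -, hx⟩ := Finset.mem_image.1 (show a ∈ Finset.univ.image κ by simp [hi])
    obtain ⟨y, -, hy⟩ := Finset.mem_image.1 (show b ∈ Finset.univ.image κ by simp [hi])
    exact hab (hx.symm.trans ((eq_of_reachable hκ.adj (hc.preconnected x y)).trans hy))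
  · rintro F ⟨-, hF⟩ hFc e he
    by_contra heF
    obtain ⟨u, v, huv, hχ, rfl⟩ := he
    have hmono : G.deleteEdges (cut G χ) ≤ G.deleteEdges F := SimpleGraph.deleteEdges_anti hFc
    have hadj : (G.deleteEdges F).Adj u v := SimpleGraph.deleteEdges_adj.2 ⟨huv, heF⟩
    have hne : κ u ≠ κ v := fun h => by
      have hc : ∀ x, χ x = χ (κ x) := fun x =>
        eq_of_reachable (fun x y h => (deleteEdges_cut_adj.1 h).2) (hκ.reachable x)
      exact hχ (by rw [hc u, hc v, h])
    have hi : Finset.univ.image κ = {κ u, κ v} := by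
      refine (Finset.eq_of_subset_of_card_le ?_ ?_).symm
      · simp [Finset.insert_subset_iff]
      · rw [h2, Finset.card_pair hne]
    have hr : ∀ x, (G.deleteEdges F).Reachable x u := fun x => by
      have hx := Finset.mem_image_of_mem κ (Finset.mem_univ x)
      have h1 := (hκ.reachable x).mono hmono
      have h2 := fun y => ((hκ.reachable y).mono hmono).symm
      rw [hi, Finset.mem_insert, Finset.mem_singleton] at hx
      obtain hx | hx := hx
      · exact (hx ▸ h1).trans (h2 u)
      · exact ((hx ▸ h1).trans (h2 v)).trans hadj.symm.reachable
    exact hF ((SimpleGraph.connected_iff _).2 ⟨fun x y => (hr x).trans (hr y).symm, ⟨u⟩⟩)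

/-- Fix an edge `uv` of `F`. Putting it back reconnects the graph, so every vertex reaches `u` or
`v` without `F`, while `u` and `v` are separated. Colouring by reachability of `u` gives a
disconnecting cut inside `F`, which is `F` by minimality. -/
theorem IsBond.exists_cut {F : Set (Sym2 V)} (hG : G.Connected) (hF : IsBond G F) :
    ∃ χ, cut G χ = F ∧ ∀ κ, IsComponentMap G χ κ → (Finset.univ.image κ).card = 2 := by
  classical
  obtain ⟨⟨hFG, hFc⟩, hmin⟩ := hF
  obtain ⟨e, he⟩ : F.Nonempty := by
    by_contra h
    rw [Set.not_nonempty_iff_eq_empty] at h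
    exact hFc (by rwa [h, SimpleGraph.deleteEdges_empty])
  induction e using Sym2.ind with
  | _ u v =>
  set H := G.deleteEdges F with hH
  have hu : ∀ x, H.Reachable x u ∨ H.Reachable x v := by
    have hc : (G.deleteEdges (F \ {s(u, v)})).Connected := by
      by_contra hc
      exact (hmin ⟨Set.sdiff_subset.trans hFG, hc⟩ Set.sdiff_subset he).2 rfl
    intro x
    have hstep : ∀ a b, (G.deleteEdges (F \ {s(u, v)})).Adj a b →
        (H.Reachable b u ∨ H.Reachable b v) → (H.Reachable a u ∨ H.Reachable a v) := by
      intro a b hab hb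
      obtain ⟨hab, habF⟩ := SimpleGraph.deleteEdges_adj.1 hab
      by_cases hF : s(a, b) ∈ F
      · have hab' : s(a, b) = s(u, v) := by
          by_contra h
          exact habF ⟨hF, h⟩
        obtain ⟨rfl, -⟩ | ⟨rfl, -⟩ := Sym2.eq_iff.1 hab'
        exacts [.inl (.refl _), .inr (.refl _)]
      · have h : H.Adj a b := SimpleGraph.deleteEdges_adj.2 ⟨hab, hF⟩
        exact hb.imp h.reachable.trans h.reachable.trans
    have hwalk : ∀ a b, (G.deleteEdges (F \ {s(u, v)})).Walk a b →
        (H.Reachable b u ∨ H.Reachable b v) → (H.Reachable a u ∨ H.Reachable a v) := by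
      intro a b w hb
      induction w with
      | nil => exact hb
      | cons h _ ih => exact hstep _ _ h (ih hb)
    obtain ⟨w⟩ := hc.preconnected x u
    exact hwalk _ _ w (.inl (.refl _))
  have huv : ¬ H.Reachable u v := fun h => by
    refine hFc ((SimpleGraph.connected_iff _).2 ⟨fun x y => ?_, ⟨u⟩⟩)
    have h' : ∀ x, H.Reachable x u := fun x => (hu x).elim id fun h'' => h''.trans h.symm
    exact (h' x).trans (h' y).symm
  let χ : V → Bool := fun x => decide (H.Reachable x u)
  have hχ : ∀ x y, H.Adj x y → χ x = χ y := fun x y hxy => by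
    have : H.Reachable x u ↔ H.Reachable y u :=
      ⟨hxy.symm.reachable.trans, hxy.reachable.trans⟩
    simp only [χ, this]
  have hsub : cut G χ ⊆ F := by
    rintro _ ⟨x, y, hxy, hne, rfl⟩
    by_contra hF
    exact hne (hχ x y (SimpleGraph.deleteEdges_adj.2 ⟨hxy, hF⟩))
  have hcut : cut G χ = F := by
    refine hsub.antisymm (hmin ⟨cut_subset χ, fun hc => ?_⟩ hsub)
    have h1 : χ u = χ v :=
      eq_of_reachable (fun x y h => (deleteEdges_cut_adj.1 h).2) (hc.preconnected u v)
    have h2 : χ u = true := decide_eq_true (.refl _)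
    have h3 : χ v = false := decide_eq_false fun h => huv h.symm
    simp [h2, h3] at h1
  refine ⟨χ, hcut, fun κ hκ => ?_⟩
  obtain ⟨h1, h2⟩ := hκ
  rw [hcut] at h1 h2
  rw [Finset.card_eq_two]
  refine ⟨κ u, κ v, fun h => huv ((h2 u).trans (h ▸ (h2 v).symm)), ?_⟩
  ext y
  simp only [Finset.mem_image, Finset.mem_univ, true_and, Finset.mem_insert, Finset.mem_singleton]
  constructor
  · rintro ⟨x, rfl⟩
    exact (hu x).imp (eq_of_reachable h1) (eq_of_reachable h1)
  · rintro (rfl | rfl)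
    exacts [⟨u, rfl⟩, ⟨v, rfl⟩]

end Cuts

end LargestBond

namespace LargestBond

open NTree Relation

/-! ### The bound for the running time -/

/-- With `b = k + 1 ≥ 2` and `M` the table bound, `M ≤ b ^ (5 * k)` and the node cost is `O(M ^ 4 *
b ^ 2)`. All constants become powers of `b`, and the exponent is `16 + 20 * k ≤ 36 * k`. The factor
`k` on the left comes from the number of nodes. -/
theorem nodeCost_le {k : ℕ} (hk : 1 ≤ k) :
    2 * nodeCost (tableBound k) k * k ≤ (k + 1) ^ (36 * k) := by
  obtain ⟨b, hb⟩ : ∃ b, b = k + 1 := ⟨_, rfl⟩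
  have hb2 : 2 ≤ b := by omega
  have hkb : k ≤ b := by omega
  obtain ⟨M, hM⟩ : ∃ M, M = tableBound k := ⟨_, rfl⟩
  have hM1 : 1 ≤ M := by have := four_le_tableBound k; omega
  have hMb : M ≤ b ^ (5 * k) := by
    calc M = 2 ^ 2 * (2 * b * b) ^ k := by rw [hM, tableBound, hb]; rfl
      _ ≤ b ^ 2 * (b * b * b) ^ k := by gcongr
      _ = b ^ (2 + 3 * k) := by ring
      _ ≤ b ^ (5 * k) := Nat.pow_le_pow_right (by omega) (by omega)
  have h1 : opCost (M * M) k ≤ 2000 * (M ^ 2 * b ^ 2) := by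
    have e1 : M * M * (120 * k + 110) ≤ M * M * (230 * b ^ 2) := by gcongr; nlinarith
    have e2 : k * (200 * k + 500) ≤ 1 * (700 * b ^ 2) := by nlinarith
    have e3 : 300 ≤ 1 * (300 * b ^ 2) := by nlinarith
    have e4 : 1 * b ^ 2 ≤ M ^ 2 * b ^ 2 := Nat.mul_le_mul_right _ (Nat.one_le_pow _ _ hM1)
    unfold opCost
    nlinarith
  have h2 : rowCost M k ≤ 2100 * (M ^ 3 * b ^ 2) := by
    have e1 : 1 ≤ M ^ 2 * b ^ 2 := Nat.mul_pos (by positivity) (by positivity)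
    have e2 : 1 ≤ M ^ 3 * b ^ 2 := Nat.mul_pos (by positivity) (by positivity)
    have e3 : (opCost (M * M) k + 60) * M ≤ (2060 * (M ^ 2 * b ^ 2)) * M := by
      gcongr
      omega
    have e4 : (2060 * (M ^ 2 * b ^ 2)) * M = 2060 * (M ^ 3 * b ^ 2) := by ring
    unfold rowCost
    omega
  have h3 : nodeCost M k ≤ 2 ^ 12 * (M ^ 4 * b ^ 2) := by
    have e1 : 1 ≤ M ^ 3 * b ^ 2 := Nat.mul_pos (by positivity) (by positivity)
    have e2 : 1 ≤ M ^ 4 * b ^ 2 := Nat.mul_pos (by positivity) (by positivity)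
    have e3 : (rowCost M k + 60) * M ≤ (2160 * (M ^ 3 * b ^ 2)) * M := by
      gcongr
      omega
    have e4 : (2160 * (M ^ 3 * b ^ 2)) * M = 2160 * (M ^ 4 * b ^ 2) := by ring
    unfold nodeCost
    omega
  rw [← hM, ← hb]
  calc 2 * nodeCost M k * k ≤ 2 * (2 ^ 12 * (M ^ 4 * b ^ 2)) * b := by gcongr
    _ = 2 ^ 13 * M ^ 4 * b ^ 3 := by ring
    _ ≤ b ^ 13 * (b ^ (5 * k)) ^ 4 * b ^ 3 := by gcongr
    _ = b ^ (16 + 20 * k) := by ring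
    _ ≤ b ^ (36 * k) := Nat.pow_le_pow_right (by omega) (by omega)

theorem exists_time_bound : ∃ K₀ : ℕ, ∀ C K w n T : ℕ, C * K₀ ≤ K → K₀ ≤ K →
    T ≤ 2 * nodeCost (tableBound (w + 1)) (w + 1) * (C * (w + 1) * n) →
    (T : ℝ) ≤ (K : ℝ) * (2 : ℝ) ^ ((K : ℝ) * (w : ℝ) * Real.logb 2 (w : ℝ)) * (n : ℝ) := by
  -- `3 ^ 72` is the value of `(w + 2) ^ (36 * (w + 1))` at `w = 1`, which settles widths 0 and 1,
  -- where the exponential gives no help. For `w ≥ 2`, `w + 2 ≤ w ^ 2` yields `w ^ (144 * w)`, and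
  -- `144 ≤ K` suffices.
  refine ⟨3 ^ 72, fun C K w n T hC hK hT => ?_⟩
  have h1 : 2 * nodeCost (tableBound (w + 1)) (w + 1) * (C * (w + 1) * n) ≤
      C * (w + 2) ^ (36 * (w + 1)) * n := by
    calc 2 * nodeCost (tableBound (w + 1)) (w + 1) * (C * (w + 1) * n)
        = C * (2 * nodeCost (tableBound (w + 1)) (w + 1) * (w + 1)) * n := by ring
      _ ≤ C * (w + 2) ^ (36 * (w + 1)) * n := by
        gcongr
        exact nodeCost_le (by omega)
  have hlog : 0 ≤ Real.logb 2 (w : ℝ) := by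
    obtain rfl | hw := Nat.eq_zero_or_pos w
    · simp
    · exact Real.logb_nonneg one_lt_two (by exact_mod_cast hw)
  have hT' : (T : ℝ) ≤ (C * (w + 2) ^ (36 * (w + 1)) * n : ℕ) := by exact_mod_cast hT.trans h1
  refine hT'.trans ?_
  push_cast
  gcongr ?_ * _
  obtain hw | hw := Nat.lt_or_ge w 2
  · have h2 : C * (w + 2) ^ (36 * (w + 1)) ≤ K := by
      refine le_trans (Nat.mul_le_mul_left C ?_) hC
      calc (w + 2) ^ (36 * (w + 1)) ≤ 3 ^ (36 * (w + 1)) := by gcongr; omega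
        _ ≤ 3 ^ 72 := Nat.pow_le_pow_right (by norm_num) (by omega)
    have h3 : (1 : ℝ) ≤ (2 : ℝ) ^ ((K : ℝ) * (w : ℝ) * Real.logb 2 (w : ℝ)) :=
      Real.one_le_rpow one_le_two (by positivity)
    calc (C : ℝ) * (w + 2) ^ (36 * (w + 1)) ≤ K := by exact_mod_cast h2
      _ ≤ K * (2 : ℝ) ^ ((K : ℝ) * (w : ℝ) * Real.logb 2 (w : ℝ)) :=
        le_mul_of_one_le_right (by positivity) h3
  · have h2 : (w + 2) ^ (36 * (w + 1)) ≤ w ^ (144 * w) := by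
      calc (w + 2) ^ (36 * (w + 1)) ≤ (w ^ 2) ^ (36 * (w + 1)) := by gcongr; nlinarith
        _ = w ^ (72 * (w + 1)) := by rw [← pow_mul]; ring_nf
        _ ≤ w ^ (144 * w) := Nat.pow_le_pow_right (by omega) (by omega)
    have h3 : (w : ℝ) ^ (144 * w) ≤ (2 : ℝ) ^ ((K : ℝ) * (w : ℝ) * Real.logb 2 (w : ℝ)) := by
      have hw0 : (0 : ℝ) < w := by exact_mod_cast (show 0 < w by omega)
      calc (w : ℝ) ^ (144 * w) = (2 : ℝ) ^ (Real.logb 2 (w : ℝ) * ((144 * w : ℕ) : ℝ)) := by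
            rw [Real.rpow_mul zero_le_two, Real.rpow_logb two_pos (by norm_num) hw0,
              Real.rpow_natCast]
        _ ≤ (2 : ℝ) ^ ((K : ℝ) * (w : ℝ) * Real.logb 2 (w : ℝ)) := by
          refine Real.rpow_le_rpow_of_exponent_le one_le_two ?_
          have : (144 : ℝ) ≤ K := by
            exact_mod_cast (show 144 ≤ 3 ^ 72 by norm_num).trans hK
          push_cast
          rw [mul_comm]
          gcongr
    have h4 : (C : ℝ) ≤ K := by
      exact_mod_cast (Nat.le_mul_of_pos_right C (by positivity)).trans hC
    calc (C : ℝ) * (w + 2) ^ (36 * (w + 1)) ≤ K * (w : ℝ) ^ (144 * w) := by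
          gcongr
          exact_mod_cast h2
      _ ≤ _ := by gcongr

/-! ### Correctness of the program -/

variable {n : ℕ} {G : SimpleGraph (Fin n)} {t : NTree (Fin n)}

theorem IsNiceTreeDecomposition.adj_iff (h : IsNiceTreeDecomposition G t) {u v : Fin n} :
    G.Adj u v ↔ (u, v) ∈ t.pairs ∨ (v, u) ∈ t.pairs := by
  rw [← SimpleGraph.mem_edgeSet, ← h.mem_edges, t.edges_eq_map, List.mem_map]
  constructor
  · rintro ⟨⟨x, y⟩, hp, he⟩
    obtain ⟨rfl, rfl⟩ | ⟨rfl, rfl⟩ := Sym2.eq_iff.1 he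
    exacts [.inl hp, .inr hp]
  · rintro (hp | hp)
    exacts [⟨_, hp, rfl⟩, ⟨_, hp, Sym2.eq_swap⟩]

theorem IsNiceTreeDecomposition.isComponentMap (h : IsNiceTreeDecomposition G t)
    {χ : Fin n → Bool} {κ : Fin n → Fin n} (hκ : t.IsLabeling χ κ) : IsComponentMap G χ κ where
  adj u v huv := by
    obtain ⟨huv, hχ⟩ := deleteEdges_cut_adj.1 huv
    obtain huv | huv := h.adj_iff.1 huv
    exacts [hκ.mono u v ⟨huv, hχ⟩, (hκ.mono v u ⟨huv, hχ.symm⟩).symm]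
  reachable u := by
    have key : ∀ x y, EqvGen (t.Mono χ) x y → (G.deleteEdges (cut G χ)).Reachable x y := by
      intro x y hxy
      induction hxy with
      | rel x y hxy =>
        exact (deleteEdges_cut_adj.2 ⟨h.adj_iff.2 (.inl hxy.1), hxy.2⟩).reachable
      | refl x => exact .refl _
      | symm x y _ ih => exact ih.symm
      | trans x y z _ _ ih1 ih2 => exact ih1.trans ih2
    exact key _ _ (hκ.conn u)

theorem IsNiceTreeDecomposition.closed_eq (h : IsNiceTreeDecomposition G t) (κ : Fin n → Fin n) :
    t.closed κ = Finset.univ.image κ := by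
  rw [closed, h.root_bag, Finset.sdiff_empty, Finset.eq_univ_of_forall h.mem_verts]

theorem IsNiceTreeDecomposition.listsEdges (h : IsNiceTreeDecomposition G t) (χ : Fin n → Bool) :
    ListsEdges (t.cutPairs χ) (cut G χ) := by
  constructor
  · exact (t.edges_eq_map ▸ h.edges_nodup).sublist (List.filter_sublist.map _)
  · ext e
    simp only [Set.mem_ofPred_eq, List.mem_map, cutPairs, List.mem_filter, bne_iff_ne]
    constructor
    · rintro ⟨u, v, huv, hχ, rfl⟩
      obtain huv | huv := h.adj_iff.1 huv
      exacts [⟨_, ⟨huv, hχ⟩, rfl⟩, ⟨_, ⟨huv, hχ.symm⟩, Sym2.eq_swap⟩]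
    · rintro ⟨⟨u, v⟩, ⟨huv, hχ⟩, rfl⟩
      exact ⟨u, v, h.adj_iff.2 (.inl huv), hχ, rfl⟩

theorem ListsEdges.encard_eq {L : List (Fin n × Fin n)} {F : Set (Sym2 (Fin n))}
    (h : ListsEdges L F) : F.encard = L.length := by
  have : F = ((L.map fun e => s(e.1, e.2)).toFinset : Set (Sym2 (Fin n))) := by
    rw [List.coe_toFinset]
    exact h.2
  rw [this, Set.encard_coe_eq_coe_finsetCard, List.toFinset_card_of_nodup h.1, List.length_map]

theorem encodeEdgeList_eq (L : List (Fin n × Fin n)) :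
    encodeEdgeList L = encodeList encodePair (L.map fun p => ((p.1 : ℕ), (p.2 : ℕ))) := by
  induction L with
  | nil => rfl
  | cons p L ih => rw [encodeEdgeList, ih]; rfl

theorem pick_spec (A : List Entry) :
    (∃ e ∈ A, e.1.1 = 2 ∧ pick A = e.2.2) ∨ (∀ e ∈ A, e.1.1 ≠ 2) ∧ pick A = .nil := by
  induction A with
  | nil => exact .inr ⟨by simp, rfl⟩
  | cons a A ih =>
    unfold pick
    split_ifs with h
    · exact .inl ⟨a, .head _, h, rfl⟩
    · obtain ⟨e, he, h1, h2⟩ | ⟨h1, h2⟩ := ih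
      · exact .inl ⟨e, .tail _ he, h1, h2⟩
      · exact .inr ⟨List.forall_mem_cons.2 ⟨h, h1⟩, h2⟩

theorem IsNiceTreeDecomposition.length_pairs_le (h : IsNiceTreeDecomposition G t) :
    t.pairs.length ≤ (n + 1) ^ 2 := by
  calc t.pairs.length = t.edges.length := by rw [t.edges_eq_map, List.length_map]
    _ ≤ Fintype.card (Sym2 (Fin n)) := h.edges_nodup.length_le_card
    _ = (n + 1).choose 2 := by rw [Sym2.card, Fintype.card_fin]
    _ ≤ (n + 1) ^ 2 := Nat.choose_le_pow _ _

theorem numNodes_pos (t : NTree (Fin n)) : 1 ≤ t.numNodes := by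
  cases t <;> simp [numNodes]

/-- For every bond there is an entry with two closed components that is at least as large. -/
theorem IsNiceTreeDecomposition.exists_entry (h : IsNiceTreeDecomposition G t)
    (hG : G.Connected) {F : Set (Sym2 (Fin n))} (hF : IsBond G F) :
    ∃ e ∈ table t, e.1.1 = 2 ∧ F.encard ≤ e.2.1 := by
  obtain ⟨χ, rfl, hχ⟩ := hF.exists_cut hG
  obtain ⟨e, he, hr, hv⟩ := exists_mem_table h.proper χ
  refine ⟨e, he, ?_, ?_⟩
  · obtain ⟨X, κ, -, -, hκ, -, hc⟩ := hr
    rw [hc, h.closed_eq, hχ κ (h.isComponentMap hκ)]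
    rfl
  · rw [(h.listsEdges χ).encard_eq]
    exact_mod_cast hv

/-- The solution that the program picks is a maximum bond, or there is no bond. -/
theorem IsNiceTreeDecomposition.exists_solution (h : IsNiceTreeDecomposition G t)
    (hG : G.Connected) :
    (pick (table t)).size ≤ t.numNodes ∧ ∃ L : List (Fin n × Fin n),
      (pick (table t)).toList = L.map (fun p => ((p.1 : ℕ), (p.2 : ℕ))) ∧
      ((∃ F : Set (Sym2 (Fin n)), IsMaximumBond G F ∧ ListsEdges L F) ∨
        (L = [] ∧ ¬ ∃ F : Set (Sym2 (Fin n)), IsBond G F)) := by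
  obtain ⟨e, he, h2, hp⟩ | ⟨h2, hp⟩ := pick_spec (table t)
  · obtain ⟨χ, hχ⟩ := exists_describes h.proper he
    rw [hp]
    refine ⟨hχ.size, t.cutPairs χ, hχ.toList, .inl ⟨cut G χ, ⟨?_, fun F hF => ?_⟩,
      h.listsEdges χ⟩⟩
    · obtain ⟨X, κ, -, -, hκ, -, hc⟩ := hχ.state
      rw [h.closed_eq] at hc
      -- The cap 3 exceeds 2, so a capped count of 2 is exact.
      exact isBond_cut (h.isComponentMap hκ) (by omega)
    · obtain ⟨f, hf, hf2, hFf⟩ := h.exists_entry hG hF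
      have hnil : ∀ g ∈ table t, g.1.2 = [] := fun g hg => by
        have := (entry_bounds h.proper hg).1
        rw [h.root_bag, Finset.card_empty] at this
        exact List.eq_nil_of_length_eq_zero this
      -- The root bag is empty, so the count is the whole state and only one entry has count 2;
      -- picking the first one loses nothing.
      have hef : f = e := List.inj_on_of_nodup_map (nodup_table t) hf he
        (Prod.ext (hf2.trans h2.symm) ((hnil f hf).trans (hnil e he).symm))
      rw [(h.listsEdges χ).encard_eq, ← hχ.value, ← hef]
      exact hFf
  · rw [hp]
    refine ⟨numNodes_pos t, [], rfl, .inr ⟨rfl, ?_⟩⟩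
    rintro ⟨F, hF⟩
    obtain ⟨e, he, he2, -⟩ := h.exists_entry hG hF
    exact h2 e he he2

end LargestBond

theorem mainTheorem6 :
    ∃ P : LargestBond.Program, ∀ C : ℕ, ∃ K : ℕ,
      ∀ (n : ℕ) (G : SimpleGraph (Fin n)) (t : LargestBond.NTree (Fin n)),
        G.Connected → LargestBond.IsNiceTreeDecomposition G t →
        t.numNodes ≤ C * (t.width + 1) * n →
        ∃ (L : List (Fin n × Fin n)) (T : ℕ),
          P.Computes ((n + 1) ^ K) t.encode (LargestBond.encodeEdgeList L) T ∧
          (T : ℝ) ≤ (K : ℝ) * (2 : ℝ) ^ ((K : ℝ) * (t.width : ℝ) * Real.logb 2 (t.width : ℝ)) *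
            (n : ℝ) ∧
          ((∃ F : Set (Sym2 (Fin n)), LargestBond.IsMaximumBond G F ∧
              LargestBond.ListsEdges L F) ∨
            (L = [] ∧ ¬ ∃ F : Set (Sym2 (Fin n)), LargestBond.IsBond G F)) := by
  obtain ⟨K₀, hK₀⟩ := LargestBond.exists_time_bound
  -- The summand 3 serves the word size: `(n + 1) ^ 2` bounds the number of edges, and `(n + 1) ^ 3
  -- ≥ 6` bounds the sum of two capped counts.
  refine ⟨LargestBond.bondProgram, fun C => ⟨C * K₀ + K₀ + 3, fun n G t hG ht hn => ?_⟩⟩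
  obtain ⟨hsize, L, hL, hbond⟩ := ht.exists_solution hG
  have hpos : 2 ≤ n + 1 := by
    obtain ⟨v⟩ := hG.nonempty
    have := v.pos
    omega
  have hpow : ∀ m ≤ C * K₀ + K₀ + 3, (n + 1) ^ m ≤ (n + 1) ^ (C * K₀ + K₀ + 3) :=
    fun m hm => Nat.pow_le_pow_right (by omega) hm
  have hW : 6 ≤ (n + 1) ^ (C * K₀ + K₀ + 3) := by
    refine le_trans ?_ (hpow 3 (by omega))
    calc 6 ≤ 2 ^ 3 := by norm_num
      _ ≤ (n + 1) ^ 3 := by gcongr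
  obtain ⟨T, hT, hTle⟩ := LargestBond.bondProgram_computes (k := t.width + 1) ht.proper
    -- An inequality is enough, so the truncated subtraction in `width` does no harm.
    (by unfold LargestBond.NTree.width; omega)
    (ht.length_pairs_le.trans (hpow 2 (by omega))) hW hsize
  refine ⟨L, T, ?_, hK₀ C _ t.width n T (by omega) (by omega) (hTle.trans ?_), hbond⟩
  · rw [LargestBond.encodeEdgeList_eq, ← hL]
    exact hT
  · gcongr
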